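/- **Setting.** There are $K\ge 3$ arms and $\delta\in(0,1)$. The rewards of arm $a$ are i.i.d. with mean $\mu_a$, and $\mathbb E\,e^{t(X-\mu_a)}\le e^{t^2/4}$ for all $t\in\mathbb R$ (for example, rewards in $[0,1]$). Write $\mu_{(1)}\ge\dots\ge\mu_{(K)}$ for the sorted means, $\Delta_{a,j}=\mu_j-\mu_a$ and $\Delta_{\max}=\max_{1\le j<K}(\mu_{(j)}-\mu_{(j+1)})$. Assume that this maximum is attained at a single index $m$, and that no other arm has the same mean as arm $(m)$ or the same mean as arm $(m+1)$. Arms other than $(m),(m+1)$ are called suboptimal. **Confidence bounds.** Let $c_s=\sqrt{\log(4Ks^2/\delta)/s}$, and let $\hat\mu_{a,s}$ be the mean of the first $s$ samples of arm $a$. When arm $a$ has been sampled $T_a$ times, its confidence interval is $[l_a,r_a]$ with $l_a=\max_{1\le s\le T_a}(\hat\mu_{a,s}-c_s)$ and $r_a=\min_{1\le s\le T_a}(\hat\mu_{a,s}+c_s)$. For $x\in\mathbb R$ let $G^r_a(x)=\min_{j:\,l_j>x}r_j-x$ if some $l_j>x$, and $G^r_a(x)=\max_{j\ne a}r_j-x$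 otherwise; let $G^l_a(x)=x-\max_{j:\,r_j<x}l_j$ if some $r_j<x$, and $G^l_a(x)=x-\min_{j\neq a}l_j$ otherwise. Put $$U\Delta_a=\max\Big\{\max_{j:\,l_j\in[l_a,r_a]}G^r_a(l_j),\ \max_{j:\,r_j\in[l_a,r_a]}G^l_a(r_j)\Big\},\qquad L\Delta=\max_{\emptyset\ne S\subsetneq[K]}\Big(\min_{a\in S}l_a-\max_{a\notin S}r_a\Big).$$ **Algorithms.** *MaxGapElim* starts with all arms active. In every round it samples each active arm once, recomputes the bounds (an arm that is no longer active keeps its last interval), deletes every active arm $a$ with $U\Delta_a\le L\Delta$, and stops when at most two arms are active. *MaxGapUCB*, with parameter $c>0$, samples all arms in the first round; in every later round it samples all arms $a$ whose $U\Delta_a$ is maximal. It stops at the end of the first round after which $T_i+T_j\ge c\sum_{a\notin\{i,j\}}T_a$ for some $i\neq j$. **Hardness.** With the convention that a maximum over the empty set is $\infty$, let $$\gamma^r_a=\max_{j:\,0<\Delta_{a,j}<\Delta_{\max}}\min\{\Delta_{a,j},\Delta_{\max}-\Delta_{a,j}\},\qquad \gamma^l_a=\max_{j:\,0<\Delta_{j,a}<\Delta_{\max}}\min\{\Delta_{j,a},\Delta_{\max}-\Delta_{j,a}\},$$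 $$\rho^r_a=\max\Big\{\max_{j:\,\Delta_{a,j}>0}\min\{\tfrac{\Delta_{a,j}}4,\tfrac{\Delta_{\max}-\Delta_{a,j}}8\},\ \tfrac{\Delta_{\max}-(\mu_{(1)}-\mu_a)}8\Big\},$$ $$\rho^l_a=\max\Big\{\max_{j:\,\Delta_{j,a}>0}\min\{\tfrac{\Delta_{j,a}}4,\tfrac{\Delta_{\max}-\Delta_{j,a}}8\},\ \tfrac{\Delta_{\max}-(\mu_a-\mu_{(K)})}8\Big\},$$ and $\gamma_a=\min\{\gamma_a^l,\gamma_a^r\}$, $\rho_a=\min\{\rho^l_a,\rho^r_a\}$; these are finite and positive for suboptimal arms. Put $h(g)=\max\{1,\log(K/(\delta g))/g^2\}$. **Theorem.** There are universal constants $\alpha,C>0$ such that for all $K\ge3$ and $\delta\in(0,1)$: 1. For all $x>0$ and integers $s\ge1$, if $s\ge\alpha\log(K/(\delta x))/x^2$, then $c_s\le x$. 2. For every instance as above, with probability at least $1-\delta$, MaxGapElim stops, each suboptimal arm $a$ is sampled at most $\alpha\,h(\rho_a)$ times, and the total number of samples of all arms is at most $\alpha\sum_{a\notin\{(m),(m+1)\}}h(\rho_a)$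 and at most $C\sum_{a\notin\{(m),(m+1)\}}h(\gamma_a)$. 3. For every instance as above and every $c>0$, with probability at least $1-\delta$, MaxGapUCB with parameter $c$ stops, each suboptimal arm $a$ is sampled at most $6\alpha\,h(\gamma_a)$ times (hence the suboptimal arms together at most $6\alpha\sum_{a\notin\{(m),(m+1)\}}h(\gamma_a)$ times), and the total number of samples of all arms is at most $C(1+c)\sum_{a\notin\{(m),(m+1)\}}h(\gamma_a)$. -/

import Mathlib

open MeasureTheory ProbabilityTheory
open scoped NNReal ENNReal

namespace MaxGap

noncomputable section

/-! ### Finite maxima and minima -/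

/-- Maximum of `f` over a finite set; the value `0` on the empty set is a placeholder. -/
def maxOver {ι : Type*} (s : Finset ι) (f : ι → ℝ) : ℝ :=
  if h : s.Nonempty then s.sup' h f else 0

/-- Minimum of `f` over a finite set; the value `0` on the empty set is a placeholder. -/
def minOver {ι : Type*} (s : Finset ι) (f : ι → ℝ) : ℝ :=
  if h : s.Nonempty then s.inf' h f else 0

/-! ### The bandit instance -/

/-- `X a n` is the `(n+1)`-st reward of arm `a` and `μ a` is the mean of arm `a`.
The rewards of each arm are i.i.d.; the noise is sub-Gaussian with variance proxy `1/2`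
(`E exp (t (X - μ)) ≤ exp (t ^ 2 / 4)`), which covers all rewards with values in `[0, 1]`. -/
structure IsBandit {Ω : Type*} [MeasurableSpace Ω] (P : Measure Ω) {K : ℕ}
    (X : Fin K → ℕ → Ω → ℝ) (μ : Fin K → ℝ) : Prop where
  measurable : ∀ a n, Measurable (X a n)
  indep : ∀ a, iIndepFun (X a) P
  identDistrib : ∀ a n, IdentDistrib (X a n) (X a 0) P P
  mean_eq : ∀ a, ∫ ω, X a 0 ω ∂P = μ a
  subgaussian : ∀ a, HasSubgaussianMGF (fun ω => X a 0 ω - μ a) (1 / 2) P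

/-- The arms listed by decreasing mean: `rankedArm μ k` is the arm with the `(k+1)`-st largest
mean. -/
def rankedArm {K : ℕ} (μ : Fin K → ℝ) : Equiv.Perm (Fin K) := Tuple.sort (fun a => -μ a)

/-- The arm directly above the `(j+1)`-st adjacent gap. -/
def upperArm {K : ℕ} (μ : Fin K → ℝ) (j : Fin (K - 1)) : Fin K :=
  rankedArm μ ⟨j.1, by omega⟩

/-- The arm directly below the `(j+1)`-st adjacent gap. -/
def lowerArm {K : ℕ} (μ : Fin K → ℝ) (j : Fin (K - 1)) : Fin K :=
  rankedArm μ ⟨j.1 + 1, by omega⟩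

/-- The gaps between adjacent means. -/
def adjGap {K : ℕ} (μ : Fin K → ℝ) (j : Fin (K - 1)) : ℝ := μ (upperArm μ j) - μ (lowerArm μ j)

/-- The largest gap between adjacent means. -/
def deltaMax {K : ℕ} (μ : Fin K → ℝ) : ℝ := maxOver Finset.univ (adjGap μ)

/-- The largest gap is attained at position `m` only, and the two arms adjacent to it are
determined by their means. -/
structure UniqueMaxGap {K : ℕ} (μ : Fin K → ℝ) (m : Fin (K - 1)) : Prop where
  gap_lt : ∀ j, j ≠ m → adjGap μ j < adjGap μ m
  upper_unique : ∀ a, μ a = μ (upperArm μ m) → a = upperArm μ m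
  lower_unique : ∀ a, μ a = μ (lowerArm μ m) → a = lowerArm μ m

/-- All arms except the two that are adjacent to the gap at position `m`. -/
def suboptimal {K : ℕ} (μ : Fin K → ℝ) (m : Fin (K - 1)) : Finset (Fin K) :=
  Finset.univ \ {upperArm μ m, lowerArm μ m}

/-! ### Hardness parameters -/

/-- A maximum that is `∞` over the empty set. -/
def maxOrTop {ι : Type*} (s : Finset ι) (f : ι → ℝ) : EReal :=
  if s.Nonempty then ((maxOver s f : ℝ) : EReal) else ⊤

/-- `γ_a^r`, with `Δ_{a,j} = μ j - μ a`. -/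
def gammaRight {K : ℕ} (μ : Fin K → ℝ) (a : Fin K) : EReal :=
  maxOrTop (Finset.univ.filter fun j => 0 < μ j - μ a ∧ μ j - μ a < deltaMax μ)
    (fun j => min (μ j - μ a) (deltaMax μ - (μ j - μ a)))

/-- `γ_a^l`. -/
def gammaLeft {K : ℕ} (μ : Fin K → ℝ) (a : Fin K) : EReal :=
  maxOrTop (Finset.univ.filter fun j => 0 < μ a - μ j ∧ μ a - μ j < deltaMax μ)
    (fun j => min (μ a - μ j) (deltaMax μ - (μ a - μ j)))

/-- `γ_a`; it is finite and positive for every suboptimal arm. -/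
def gamma {K : ℕ} (μ : Fin K → ℝ) (a : Fin K) : ℝ := (min (gammaLeft μ a) (gammaRight μ a)).toReal

/-- `ρ_a^r`: infinite if no arm has a larger mean than `a`. -/
def rhoRight {K : ℕ} (μ : Fin K → ℝ) (a : Fin K) : EReal :=
  max (maxOrTop (Finset.univ.filter fun j => 0 < μ j - μ a)
      (fun j => min ((μ j - μ a) / 4) ((deltaMax μ - (μ j - μ a)) / 8)))
    (((deltaMax μ - (maxOver Finset.univ μ - μ a)) / 8 : ℝ) : EReal)

/-- `ρ_a^l`: infinite if no arm has a smaller mean than `a`. -/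
def rhoLeft {K : ℕ} (μ : Fin K → ℝ) (a : Fin K) : EReal :=
  max (maxOrTop (Finset.univ.filter fun j => 0 < μ a - μ j)
      (fun j => min ((μ a - μ j) / 4) ((deltaMax μ - (μ a - μ j)) / 8)))
    (((deltaMax μ - (μ a - minOver Finset.univ μ)) / 8 : ℝ) : EReal)

/-- `ρ_a`; it is finite and positive for every suboptimal arm. -/
def rho {K : ℕ} (μ : Fin K → ℝ) (a : Fin K) : ℝ := (min (rhoLeft μ a) (rhoRight μ a)).toReal

/-- The number of samples that hardness `g` costs: `log (K / (δ g)) / g ^ 2`, but at least `1`. -/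
def cost (K : ℕ) (δ g : ℝ) : ℝ := max 1 (Real.log (K / (δ * g)) / g ^ 2)

/-! ### Confidence intervals on the means -/

/-- `c_s`. -/
def ciRadius (K : ℕ) (δ : ℝ) (s : ℕ) : ℝ := Real.sqrt (Real.log (4 * K * (s : ℝ) ^ 2 / δ) / s)

/-- The mean of the first `n` entries of a sequence of rewards. -/
def empMean (x : ℕ → ℝ) (n : ℕ) : ℝ := (∑ i ∈ Finset.range n, x i) / n

/-- Lower confidence bound of an arm after `n` samples: the largest of the bounds `μ̂ - c`
computed so far. -/
def lowerBound (K : ℕ) (δ : ℝ) (x : ℕ → ℝ) (n : ℕ) : ℝ :=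
  maxOver (Finset.Icc 1 n) fun s => empMean x s - ciRadius K δ s

/-- Upper confidence bound of an arm after `n` samples: the smallest of the bounds `μ̂ + c`
computed so far. -/
def upperBound (K : ℕ) (δ : ℝ) (x : ℕ → ℝ) (n : ℕ) : ℝ :=
  minOver (Finset.Icc 1 n) fun s => empMean x s + ciRadius K δ s

/-! ### Confidence bounds on the gaps, from intervals `[l a, r a]` on the means -/

/-- `G_a^r (x)`. -/
def rightGapAt {K : ℕ} (l r : Fin K → ℝ) (a : Fin K) (x : ℝ) : ℝ :=
  if (Finset.univ.filter fun j => x < l j).Nonempty then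
    minOver (Finset.univ.filter fun j => x < l j) r - x
  else maxOver (Finset.univ.erase a) r - x

/-- `G_a^l (x)`. -/
def leftGapAt {K : ℕ} (l r : Fin K → ℝ) (a : Fin K) (x : ℝ) : ℝ :=
  if (Finset.univ.filter fun j => r j < x).Nonempty then
    x - maxOver (Finset.univ.filter fun j => r j < x) l
  else x - minOver (Finset.univ.erase a) l

/-- The upper bound `UΔ_a` on the gap of arm `a`. -/
def gapUpper {K : ℕ} (l r : Fin K → ℝ) (a : Fin K) : ℝ :=
  max
    (maxOver (Finset.univ.filter fun j => l a ≤ l j ∧ l j ≤ r a) fun j => rightGapAt l r a (l j))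
    (maxOver (Finset.univ.filter fun j => l a ≤ r j ∧ r j ≤ r a) fun j => leftGapAt l r a (r j))

/-- The lower bound `LΔ` on the largest gap: the best separation, in terms of the confidence
intervals, between the two parts of a partition of the arms. If some partition is separated
(positive value), then both of its parts are intervals in the order of the interval centres, so
it is enough to look at the splits of the sorted list. -/
def gapLower {K : ℕ} (l r : Fin K → ℝ) : ℝ :=
  maxOver (Finset.univ.filter fun S : Finset (Fin K) => S.Nonempty ∧ Sᶜ.Nonempty)
    fun S => minOver S l - maxOver Sᶜ r

/-! ### The algorithms

Both run on a table of rewards: `x a n` is what arm `a` returns when sampled for the `(n+1)`-st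
time. -/

/-- The arms that are sampled in the next round, and the numbers of samples so far. -/
structure RunState (K : ℕ) where
  next : Finset (Fin K)
  pulls : Fin K → ℕ

/-- Before the first round. -/
def initState (K : ℕ) : RunState K := ⟨Finset.univ, fun _ => 0⟩

/-- The numbers of samples after all arms in `S.next` have been sampled once more. -/
def sampleNext {K : ℕ} (S : RunState K) (a : Fin K) : ℕ := S.pulls a + if a ∈ S.next then 1 else 0

/-- The lower ends of the confidence intervals when arm `a` has been sampled `T a` times. -/
def lowers {K : ℕ} (δ : ℝ) (x : Fin K → ℕ → ℝ) (T : Fin K → ℕ) (a : Fin K) : ℝ :=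
  lowerBound K δ (x a) (T a)

/-- The upper ends of the confidence intervals when arm `a` has been sampled `T a` times. -/
def uppers {K : ℕ} (δ : ℝ) (x : Fin K → ℕ → ℝ) (T : Fin K → ℕ) (a : Fin K) : ℝ :=
  upperBound K δ (x a) (T a)

/-- One round of `MaxGapElim`: sample the active arms, then delete the active arms `a` with
`UΔ_a ≤ LΔ`. -/
def elimStep {K : ℕ} (δ : ℝ) (x : Fin K → ℕ → ℝ) (S : RunState K) : RunState K :=
  let T := sampleNext S
  let l := lowers δ x T
  let r := uppers δ x T
  ⟨S.next.filter fun a => ¬ gapUpper l r a ≤ gapLower l r, T⟩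

/-- `MaxGapElim` after `t` rounds. -/
def elimRun {K : ℕ} (δ : ℝ) (x : Fin K → ℕ → ℝ) (t : ℕ) : RunState K :=
  (elimStep δ x)^[t] (initState K)

/-- `MaxGapElim` stops after exactly `τ` rounds: at the end of the first round in which at most
two arms are active. -/
def ElimStopsAt {K : ℕ} (δ : ℝ) (x : Fin K → ℕ → ℝ) (τ : ℕ) : Prop :=
  IsLeast {t : ℕ | 1 ≤ t ∧ (elimRun δ x t).next.card ≤ 2} τ

/-- One round of `MaxGapUCB`: sample the selected arms, then select all arms whose gap upper bound
is the largest. -/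
def ucbStep {K : ℕ} (δ : ℝ) (x : Fin K → ℕ → ℝ) (S : RunState K) : RunState K :=
  let T := sampleNext S
  let l := lowers δ x T
  let r := uppers δ x T
  ⟨Finset.univ.filter fun a => gapUpper l r a = maxOver Finset.univ (gapUpper l r), T⟩

/-- `MaxGapUCB` after `t` rounds. -/
def ucbRun {K : ℕ} (δ : ℝ) (x : Fin K → ℕ → ℝ) (t : ℕ) : RunState K :=
  (ucbStep δ x)^[t] (initState K)

/-- The stopping condition of `MaxGapUCB`, with its parameter `c`. -/
def ucbStopCond {K : ℕ} (c : ℝ) (T : Fin K → ℕ) : Prop :=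
  ∃ i j : Fin K, i ≠ j ∧ c * ∑ a ∈ Finset.univ \ {i, j}, (T a : ℝ) ≤ (T i : ℝ) + (T j : ℝ)

/-- `MaxGapUCB` stops after exactly `τ` rounds. -/
def UCBStopsAt {K : ℕ} (c δ : ℝ) (x : Fin K → ℕ → ℝ) (τ : ℕ) : Prop :=
  IsLeast {t : ℕ | 1 ≤ t ∧ ucbStopCond c (ucbRun δ x t).pulls} τ

end

end MaxGap

/-!
The probabilistic part is only that all empirical means are within the confidence radius of the
means (`Accurate`), which Hoeffding's inequality and a union bound give with probability `1 - δ`;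
the rest is deterministic. On accurate tables the confidence intervals contain the means, shrink
from round to round, and stay within twice the confidence radius of the means. Statements about the
gap to the right of a point are transferred to the left by reflecting `[l, r]` to `[-r, -l]`.

*Elimination.* The difficulty is that deleted arms keep wide intervals. What saves the argument is
that an arm `i` is deleted only with `gapUpper ≤ gapLower`, and `gapLower` does not decrease.
Therefore the gap at any point that the frozen interval of `i` covers stays at most `gapLower`
(`rightGapAt_le_of_gapUpper_le`). If a lower end `x` of the interval of an active arm has a right
gap larger than `L = gapLower`, then every deleted arm beyond `x` was already known to lie beyond
`x + L` (`lt_of_gapUpper_le`). So such a gap next to a well-sampled arm forces the means to leave a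
gap there, of almost the length `deltaMax`; the definition of `rho` excludes that
(`gapUpper_le_of_active`). Moreover, unless `gapLower` has reached `deltaMax`, an arm is deleted
only once its interval lies on the correct side of the largest gap (`le_gapUpper_of_upper`), and so
`gapLower` comes within four radii of `deltaMax`.

*Upper confidence bounds.* A selected arm has `gapUpper ≥ deltaMax`, because the two arms at the
largest gap have. If a well-sampled suboptimal arm `a` is selected for a gap `[x, x + U]` to its
right, every arm whose interval meets this gap has a gap bound of at least `U`
(`rightGapAt_le_gapUpper_of_meets`), hence is selected as well. One arm does so in all these rounds
although it would close the gap once it is well sampled itself, so that the number of these rounds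
is bounded by the number of samples that makes an arm well sampled (`card_rightRounds_le`).
-/

namespace MaxGap

/-! ### Finite maxima and minima -/

section Extrema

variable {ι : Type*} {s t : Finset ι} {f g : ι → ℝ}

theorem le_maxOver {i : ι} (h : i ∈ s) : f i ≤ maxOver s f := by
  rw [maxOver, dif_pos ⟨i, h⟩]
  exact Finset.le_sup' f h

theorem minOver_le {i : ι} (h : i ∈ s) : minOver s f ≤ f i := by
  rw [minOver, dif_pos ⟨i, h⟩]
  exact Finset.inf'_le f h

theorem exists_maxOver_eq (h : s.Nonempty) : ∃ i ∈ s, maxOver s f = f i := by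
  rw [maxOver, dif_pos h]
  exact Finset.exists_mem_eq_sup' h f

theorem exists_minOver_eq (h : s.Nonempty) : ∃ i ∈ s, minOver s f = f i := by
  rw [minOver, dif_pos h]
  exact Finset.exists_mem_eq_inf' h f

theorem maxOver_le (h : s.Nonempty) {c : ℝ} (hc : ∀ i ∈ s, f i ≤ c) : maxOver s f ≤ c := by
  obtain ⟨i, hi, e⟩ := exists_maxOver_eq (f := f) h
  exact e ▸ hc i hi

theorem le_minOver (h : s.Nonempty) {c : ℝ} (hc : ∀ i ∈ s, c ≤ f i) : c ≤ minOver s f := by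
  obtain ⟨i, hi, e⟩ := exists_minOver_eq (f := f) h
  exact e ▸ hc i hi

theorem maxOver_le_maxOver (h : s.Nonempty) (hst : s ⊆ t) (hfg : ∀ i ∈ s, f i ≤ g i) :
    maxOver s f ≤ maxOver t g :=
  maxOver_le h fun i hi => (hfg i hi).trans (le_maxOver (hst hi))

theorem minOver_le_minOver (h : s.Nonempty) (hst : s ⊆ t) (hfg : ∀ i ∈ s, f i ≤ g i) :
    minOver t f ≤ minOver s g :=
  le_minOver h fun i hi => (minOver_le (hst hi)).trans (hfg i hi)

theorem minOver_neg (s : Finset ι) (f : ι → ℝ) : minOver s (fun i => -f i) = -maxOver s f := by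
  rcases s.eq_empty_or_nonempty with rfl | h
  · simp [minOver, maxOver]
  · refine le_antisymm ?_ (le_minOver h fun i hi => neg_le_neg (le_maxOver hi))
    obtain ⟨i, hi, e⟩ := exists_maxOver_eq (f := f) h
    exact e ▸ minOver_le (f := fun i => -f i) hi

theorem maxOver_neg (s : Finset ι) (f : ι → ℝ) : maxOver s (fun i => -f i) = -minOver s f := by
  have := minOver_neg s fun i => -f i
  simp only [neg_neg] at this
  rw [this, neg_neg]

end Extrema

/-! ### Reflection of intervals -/

section Intervals

variable {K : ℕ} {l r l₀ r₀ μ : Fin K → ℝ}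

theorem rightGapAt_neg (l r : Fin K → ℝ) (a : Fin K) (x : ℝ) :
    rightGapAt (fun i => -r i) (fun i => -l i) a (-x) = leftGapAt l r a x := by
  simp only [rightGapAt, leftGapAt, neg_lt_neg_iff, minOver_neg, maxOver_neg]
  split_ifs <;> ring

theorem leftGapAt_neg (l r : Fin K → ℝ) (a : Fin K) (x : ℝ) :
    leftGapAt (fun i => -r i) (fun i => -l i) a (-x) = rightGapAt l r a x := by
  have := rightGapAt_neg (fun i => -r i) (fun i => -l i) a (-x)
  simp only [neg_neg] at this
  exact this.symm

theorem gapUpper_neg (l r : Fin K → ℝ) (a : Fin K) :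
    gapUpper (fun i => -r i) (fun i => -l i) a = gapUpper l r a := by
  simp only [gapUpper, rightGapAt_neg, leftGapAt_neg, neg_le_neg_iff]
  rw [max_comm]
  simp only [and_comm]

/-! ### Gap bounds from intervals -/

theorem rightGapAt_le_gapUpper {a j : Fin K} (h₁ : l a ≤ l j) (h₂ : l j ≤ r a) :
    rightGapAt l r a (l j) ≤ gapUpper l r a :=
  le_max_of_le_left (le_maxOver (f := fun j => rightGapAt l r a (l j)) (by simp [h₁, h₂]))

theorem leftGapAt_le_gapUpper {a j : Fin K} (h₁ : l a ≤ r j) (h₂ : r j ≤ r a) :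
    leftGapAt l r a (r j) ≤ gapUpper l r a :=
  le_max_of_le_right (le_maxOver (f := fun j => leftGapAt l r a (r j)) (by simp [h₁, h₂]))

theorem gapUpper_eq {a : Fin K} (ha : l a ≤ r a) :
    (∃ j, l a ≤ l j ∧ l j ≤ r a ∧ gapUpper l r a = rightGapAt l r a (l j)) ∨
      ∃ j, l a ≤ r j ∧ r j ≤ r a ∧ gapUpper l r a = leftGapAt l r a (r j) := by
  obtain ⟨i, hi, ei⟩ := exists_maxOver_eq
    (s := Finset.univ.filter fun j => l a ≤ l j ∧ l j ≤ r a)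
    (f := fun j => rightGapAt l r a (l j)) ⟨a, by simp [ha]⟩
  obtain ⟨k, hk, ek⟩ := exists_maxOver_eq
    (s := Finset.univ.filter fun j => l a ≤ r j ∧ r j ≤ r a)
    (f := fun j => leftGapAt l r a (r j)) ⟨a, by simp [ha]⟩
  simp only [Finset.mem_filter, Finset.mem_univ, true_and] at hi hk
  rw [gapUpper, ei, ek]
  rcases max_choice (rightGapAt l r a (l i)) (leftGapAt l r a (r k)) with h | h
  · exact .inl ⟨i, hi.1, hi.2, h⟩
  · exact .inr ⟨k, hk.1, hk.2, h⟩

theorem gapLower_mono (hl : ∀ i, l₀ i ≤ l i) (hr : ∀ i, r i ≤ r₀ i) :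
    gapLower l₀ r₀ ≤ gapLower l r := by
  unfold gapLower
  rcases (Finset.univ.filter fun S : Finset (Fin K) =>
    S.Nonempty ∧ Sᶜ.Nonempty).eq_empty_or_nonempty with h | h
  · simp [h, maxOver]
  · refine maxOver_le_maxOver h subset_rfl fun S hS => ?_
    simp only [Finset.mem_filter, Finset.mem_univ, true_and] at hS
    exact sub_le_sub (minOver_le_minOver hS.1 subset_rfl fun i _ => hl i)
      (maxOver_le_maxOver hS.2 subset_rfl fun i _ => hr i)

theorem sub_le_gapLower {S : Finset (Fin K)} (hS : S.Nonempty) (hS' : Sᶜ.Nonempty) {A B : ℝ}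
    (hA : ∀ i ∈ S, A ≤ l i) (hB : ∀ i, i ∉ S → r i ≤ B) : A - B ≤ gapLower l r := by
  refine le_trans ?_ (le_maxOver (f := fun S => minOver S l - maxOver Sᶜ r) (i := S)
    (by simp [hS, hS']))
  exact sub_le_sub (le_minOver hS hA) (maxOver_le hS' fun i hi => hB i (by simpa using hi))

/-- If the left gap at `x` looks only at arms that lie below `y`, it is at least `x - y`. -/
theorem sub_le_leftGapAt {i j : Fin K} {x y : ℝ} (hji : j ≠ i) (hj : l j ≤ y)
    (h : ∀ k, r k < x → l k ≤ y) : x - y ≤ leftGapAt l r i x := by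
  rw [leftGapAt]
  split_ifs with hne
  · exact sub_le_sub_left (maxOver_le hne fun k hk => h k (by simpa using hk)) _
  · exact sub_le_sub_left ((minOver_le (by simpa using hji)).trans hj) _

theorem rightGapAt_of_nonempty {a : Fin K} {x : ℝ} (h : ∃ k, x < l k) :
    ∃ k, x < l k ∧ (∀ k', x < l k' → r k ≤ r k') ∧ rightGapAt l r a x = r k - x := by
  have hne : (Finset.univ.filter fun j => x < l j).Nonempty := by
    obtain ⟨k, hk⟩ := h
    exact ⟨k, by simpa using hk⟩
  obtain ⟨k, hk, e⟩ := exists_minOver_eq (f := r) hne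
  refine ⟨k, by simpa using hk, fun k' hk' => ?_, ?_⟩
  · rw [← e]; exact minOver_le (by simpa using hk')
  · rw [rightGapAt, if_pos hne, e]

theorem rightGapAt_of_empty {a : Fin K} {x : ℝ} (h : ∀ k, l k ≤ x) :
    rightGapAt l r a x = maxOver (Finset.univ.erase a) r - x := by
  rw [rightGapAt, if_neg]
  simpa [Finset.Nonempty] using h

/-- The gap of an arm whose interval covers the upper end `p` of a gap `(q, p)` between the means
is not underestimated. -/
theorem le_gapUpper_of_upper {p q : ℝ} (hμ : ∀ i, l i ≤ μ i ∧ μ i ≤ r i)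
    (hpq : ∀ i, p ≤ μ i ∨ μ i ≤ q) {j b : Fin K} (hj : p ≤ μ j) (hlj : l j ≤ p) (hbj : b ≠ j)
    (hb : μ b ≤ q) : p - q ≤ gapUpper l r j := by
  -- the point is the smallest upper end among the arms above the gap
  obtain ⟨i, hi, e⟩ := exists_minOver_eq (f := r) (s := Finset.univ.filter fun i => p ≤ μ i)
    ⟨j, by simpa using hj⟩
  have hmin : ∀ k, p ≤ μ k → r i ≤ r k := fun k hk => e ▸ minOver_le (by simpa using hk)
  simp only [Finset.mem_filter, Finset.mem_univ, true_and] at hi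
  have h1 : p ≤ r i := hi.trans (hμ i).2
  have h2 : r i - q ≤ leftGapAt l r j (r i) := by
    refine sub_le_leftGapAt hbj ((hμ b).1.trans hb) fun k hk => ?_
    rcases hpq k with h | h
    · exact absurd (hmin k h) (not_le.2 hk)
    · exact (hμ k).1.trans h
  have := leftGapAt_le_gapUpper (l := l) (hlj.trans h1) (hmin j hj)
  linarith

theorem le_gapUpper_of_lower {p q : ℝ} (hμ : ∀ i, l i ≤ μ i ∧ μ i ≤ r i)
    (hpq : ∀ i, p ≤ μ i ∨ μ i ≤ q) {j b : Fin K} (hj : μ j ≤ q) (hrj : q ≤ r j) (hbj : b ≠ j)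
    (hb : p ≤ μ b) : p - q ≤ gapUpper l r j := by
  have := le_gapUpper_of_upper (l := fun i => -r i) (r := fun i => -l i) (μ := fun i => -μ i)
    (p := -q) (q := -p) (fun i => ⟨neg_le_neg (hμ i).2, neg_le_neg (hμ i).1⟩)
    (fun i => by rcases hpq i with h | h <;> [right; left] <;> linarith)
    (j := j) (b := b) (by linarith) (by linarith) hbj (by linarith)
  rw [gapUpper_neg] at this
  linarith

/-! ### Arms with a small gap bound in an earlier round -/

/-- If the interval of an arm contains `x` and its gap bound was at most `L` at some time, then the
right gap at `x` of every arm is at most `L` from then on. -/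
theorem rightGapAt_le_of_gapUpper_le {L x : ℝ} {i : Fin K} (hK : ∃ k, k ≠ i)
    (hl : ∀ k, l₀ k ≤ l k) (hr : ∀ k, r k ≤ r₀ k) (hL : gapUpper l₀ r₀ i ≤ L) (h₁ : l₀ i ≤ x)
    (h₂ : x ≤ r₀ i) (a : Fin K) (ha : ∃ k, k ≠ a) : rightGapAt l r a x ≤ L := by
  -- `l₀ j` is the last of the old lower ends up to `x`
  obtain ⟨j, hj, e⟩ := exists_maxOver_eq (f := l₀) (s := Finset.univ.filter fun k => l₀ k ≤ x)
    ⟨i, by simpa using h₁⟩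
  have hmax : ∀ k, l₀ k ≤ x → l₀ k ≤ l₀ j := fun k hk => e ▸ le_maxOver (by simpa using hk)
  simp only [Finset.mem_filter, Finset.mem_univ, true_and] at hj
  have hG := (rightGapAt_le_gapUpper (hmax i h₁) (hj.trans h₂)).trans hL
  by_cases hne : ∃ k, l₀ j < l₀ k
  · obtain ⟨k, hk, -, ek⟩ := rightGapAt_of_nonempty (r := r₀) (a := i) hne
    have hxk : x < l₀ k := by
      by_contra h
      exact absurd (hmax k (not_lt.1 h)) (not_le.2 hk)
    obtain ⟨k', -, hk', ek'⟩ := rightGapAt_of_nonempty (r := r) (a := a) ⟨k, hxk.trans_le (hl k)⟩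
    have := hk' k (hxk.trans_le (hl k))
    have := hr k
    linarith
  · push Not at hne
    rw [rightGapAt_of_empty hne] at hG
    have hall : ∀ k, l₀ k ≤ x := fun k => (hne k).trans hj
    have hri : ∀ k, r₀ k ≤ x + L := by
      intro k
      by_cases hki : k = i
      · subst hki
        obtain ⟨k', hk'⟩ := hK
        have h3 := sub_le_leftGapAt (r := r₀) (x := r₀ k) hk' (hall k') fun k _ => hall k
        have h4 := leftGapAt_le_gapUpper (h₁.trans h₂) (le_refl (r₀ k))
        linarith
      · have := le_maxOver (f := r₀) (s := Finset.univ.erase i) (i := k) (by simpa using hki)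
        linarith
    by_cases hne' : ∃ k, x < l k
    · obtain ⟨k, -, -, ek⟩ := rightGapAt_of_nonempty (r := r) (a := a) hne'
      have := hri k
      have := hr k
      linarith
    · push Not at hne'
      rw [rightGapAt_of_empty hne']
      obtain ⟨k, hk⟩ := ha
      have := maxOver_le (f := r) (s := Finset.univ.erase a) (c := x + L)
        ⟨k, by simpa using hk⟩ fun k _ => (hr k).trans (hri k)
      linarith

/-- Suppose that every arm `k` to the right of `x` has `r k > x + L`. If an arm `i` to the
right of `x` had a gap bound of at most `L` at some time when it already lay to the right of `x`,
then it even lay to the right of `x + L`. -/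
theorem lt_of_gapUpper_le {L x : ℝ} {i j : Fin K} (hl : ∀ k, l₀ k ≤ l k) (hr : ∀ k, r k ≤ r₀ k)
    (hL : gapUpper l₀ r₀ i ≤ L) (hj : l j ≤ x) (hi : x < l₀ i)
    (h : ∀ k, x < l k → x + L < r k) : x + L < l₀ i := by
  -- the point is the smallest old upper end of an arm that now lies to the right of `x`
  obtain ⟨k, hk, e⟩ := exists_minOver_eq (f := r₀) (s := Finset.univ.filter fun k => x < l k)
    ⟨i, by simpa using hi.trans_le (hl i)⟩
  have hmin : ∀ k', x < l k' → r₀ k ≤ r₀ k' := fun k' hk' => e ▸ minOver_le (by simpa using hk')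
  simp only [Finset.mem_filter, Finset.mem_univ, true_and] at hk
  have hxk := (h k hk).trans_le (hr k)
  by_contra hcon
  have hji : j ≠ i := by
    rintro rfl
    exact absurd ((hl j).trans hj) (not_le.2 hi)
  have h1 := leftGapAt_le_gapUpper (l := l₀) ((not_lt.1 hcon).trans hxk.le)
    (hmin i (hi.trans_le (hl i)))
  have h2 := sub_le_leftGapAt (l := l₀) (r := r₀) (x := r₀ k) (y := x) hji ((hl j).trans hj)
    fun k' hk' => (hl k').trans (not_lt.1 fun hx => absurd (hmin k' hx) (not_le.2 hk'))
  linarith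

/-- The right half of the elimination rule, when the intervals of the active arms stay within
`2 * c` of the means, and each inactive arm had a gap bound of at most `L` when its interval was
frozen. -/
theorem rightGapAt_le_of_active {act : Fin K → Prop} {c g D L : ℝ} (hc : 0 ≤ c) (hcg : c < g)
    (hgD : 8 * g ≤ D) (hDL : D - 4 * c ≤ L) (hμ : ∀ i, l i ≤ μ i ∧ μ i ≤ r i)
    (hact : ∀ i, act i → μ i - 2 * c ≤ l i ∧ r i ≤ μ i + 2 * c)
    (hdel : ∀ i, ¬ act i → ∃ l₀ r₀ : Fin K → ℝ, (∀ k, l₀ k ≤ l k) ∧ (∀ k, r k ≤ r₀ k) ∧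
      gapUpper l₀ r₀ i ≤ L ∧ l₀ i = l i ∧ r₀ i = r i)
    (hK : ∀ i : Fin K, ∃ k, k ≠ i) {a : Fin K} (ha : act a)
    (hcond : (∃ j, 4 * g ≤ μ j - μ a ∧ 8 * g ≤ D - (μ j - μ a)) ∨ ∀ j, μ j - μ a ≤ D - 8 * g)
    {j : Fin K} (h₁ : l a ≤ l j) (h₂ : l j ≤ r a) : rightGapAt l r a (l j) ≤ L := by
  by_contra hcon
  rw [not_le] at hcon
  set x := l j with hx
  obtain ⟨ha₁, ha₂⟩ := hact a ha
  have hout : ∀ i, ¬ act i → l i ≤ x → r i < x := by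
    intro i hi hlx
    by_contra hrx
    obtain ⟨l₀, r₀, h1, h2, h3, h4, h5⟩ := hdel i hi
    exact absurd (rightGapAt_le_of_gapUpper_le (hK i) h1 h2 h3 (h4 ▸ hlx) (h5 ▸ not_lt.1 hrx) a
      (hK a)) (not_le.2 hcon)
  have hleft : ∀ i, l i ≤ x → μ i ≤ x + 2 * c ∧ r i ≤ x + 4 * c := by
    intro i hi
    by_cases hai : act i
    · have := hact i hai
      constructor <;> linarith
    · have := hout i hai hi
      have := (hμ i).2
      constructor <;> linarith
  by_cases hne : ∃ k, x < l k
  · obtain ⟨k, hk, hmin, e⟩ := rightGapAt_of_nonempty (r := r) (a := a) hne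
    have hr : ∀ i, x < l i → x + L < r i := fun i hi => by
      have := hmin i hi
      linarith
    -- no mean lies between `x + 2 * c` and `x + L - 2 * c`
    have hright : ∀ i, x < l i → x + L - 2 * c < μ i := by
      intro i hi
      by_cases hai : act i
      · have := hact i hai
        have := hr i hi
        linarith
      · obtain ⟨l₀, r₀, h1, h2, h3, h4, h5⟩ := hdel i hai
        have := lt_of_gapUpper_le h1 h2 h3 hx.ge (h4 ▸ hi) hr
        have := (hμ i).1
        linarith
    rcases hcond with ⟨j₀, h3, h4⟩ | h3
    · have : x < l j₀ := by
        by_contra h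
        have := (hleft j₀ (not_lt.1 h)).1
        linarith
      have := hright j₀ this
      linarith
    · have := h3 k
      have := hright k hk
      linarith
  · push Not at hne
    rw [rightGapAt_of_empty hne] at hcon
    obtain ⟨k, hk⟩ := hK a
    have := maxOver_le (f := r) (s := Finset.univ.erase a) (c := x + 4 * c) ⟨k, by simpa using hk⟩
      fun i _ => (hleft i (hne i)).2
    linarith

theorem gapUpper_le_of_active {act : Fin K → Prop} {c g D L : ℝ} (hc : 0 ≤ c) (hcg : c < g)
    (hgD : 8 * g ≤ D) (hDL : D - 4 * c ≤ L) (hμ : ∀ i, l i ≤ μ i ∧ μ i ≤ r i)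
    (hact : ∀ i, act i → μ i - 2 * c ≤ l i ∧ r i ≤ μ i + 2 * c)
    (hdel : ∀ i, ¬ act i → ∃ l₀ r₀ : Fin K → ℝ, (∀ k, l₀ k ≤ l k) ∧ (∀ k, r k ≤ r₀ k) ∧
      gapUpper l₀ r₀ i ≤ L ∧ l₀ i = l i ∧ r₀ i = r i)
    (hK : ∀ i : Fin K, ∃ k, k ≠ i) {a : Fin K} (ha : act a)
    (hright : (∃ j, 4 * g ≤ μ j - μ a ∧ 8 * g ≤ D - (μ j - μ a)) ∨
      ∀ j, μ j - μ a ≤ D - 8 * g)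
    (hleft : (∃ j, 4 * g ≤ μ a - μ j ∧ 8 * g ≤ D - (μ a - μ j)) ∨
      ∀ j, μ a - μ j ≤ D - 8 * g) : gapUpper l r a ≤ L := by
  rcases gapUpper_eq ((hμ a).1.trans (hμ a).2) with ⟨j, h₁, h₂, e⟩ | ⟨j, h₁, h₂, e⟩
  · rw [e]
    exact rightGapAt_le_of_active hc hcg hgD hDL hμ hact hdel hK ha hright h₁ h₂
  · rw [e, ← rightGapAt_neg]
    refine rightGapAt_le_of_active (l := fun i => -r i) (r := fun i => -l i)
      (μ := fun i => -μ i) (act := act) hc hcg hgD hDL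
      (fun i => ⟨neg_le_neg (hμ i).2, neg_le_neg (hμ i).1⟩) (fun i hi => ?_) (fun i hi => ?_) hK ha
      ?_ (neg_le_neg h₂) (neg_le_neg h₁)
    · have := hact i hi
      constructor <;> linarith
    · obtain ⟨l₀, r₀, h1, h2, h3, h4, h5⟩ := hdel i hi
      exact ⟨fun i => -r₀ i, fun i => -l₀ i, fun k => neg_le_neg (h2 k), fun k => neg_le_neg (h1 k),
        by rwa [gapUpper_neg], congrArg Neg.neg h5, congrArg Neg.neg h4⟩
    · have e : ∀ j, -μ j - -μ a = μ a - μ j := fun j => by ring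
      simpa only [e] using hleft

/-- An arm whose interval meets the gap `[x, x + U]` that gives another arm its gap bound `U` has
itself a gap bound of at least `U`. -/
theorem rightGapAt_le_gapUpper_of_meets {a i j : Fin K} (hli : l i ≤ r i) (h₁ : l j ≤ r i)
    (h₂ : l i ≤ l j + rightGapAt l r a (l j)) (hK : ∃ k, k ≠ i) (hK' : ∃ k, k ≠ a) :
    rightGapAt l r a (l j) ≤ gapUpper l r i := by
  by_cases hne : ∃ k, l j < l k
  · obtain ⟨k, hk, hmin, e⟩ := rightGapAt_of_nonempty (r := r) (a := a) hne
    rcases le_or_gt (l i) (l j) with h | h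
    · refine le_of_eq_of_le ?_ (rightGapAt_le_gapUpper h h₁)
      obtain ⟨k', hk', hmin', e'⟩ := rightGapAt_of_nonempty (r := r) (a := i) hne
      rw [e, e', le_antisymm (hmin k' hk') (hmin' k hk)]
    · have h3 := leftGapAt_le_gapUpper (l := l) (r := r) (a := i) (j := k)
        (by linarith) (hmin i h)
      have h4 := sub_le_leftGapAt (l := l) (r := r) (i := i) (j := j) (x := r k) (y := l j)
        (by rintro rfl; exact lt_irrefl _ h) le_rfl
        fun k' hk' => not_lt.1 fun hx => absurd (hmin k' hx) (not_le.2 hk')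
      linarith
  · push Not at hne
    obtain ⟨k₀, hk₀⟩ := hK'
    obtain ⟨k, -, e⟩ := exists_maxOver_eq (f := r) (s := Finset.univ.erase a)
      ⟨k₀, by simpa using hk₀⟩
    rw [rightGapAt_of_empty hne, e]
    by_cases hki : k = i
    · subst hki
      obtain ⟨k', hk'⟩ := hK
      have h3 := sub_le_leftGapAt (r := r) (x := r k) hk' (hne k') fun k _ => hne k
      have h4 := leftGapAt_le_gapUpper hli (le_refl (r k))
      linarith
    · have h3 := rightGapAt_le_gapUpper (r := r) (hne i) h₁
      rw [rightGapAt_of_empty hne] at h3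
      have := le_maxOver (f := r) (s := Finset.univ.erase i) (i := k) (by simpa using hki)
      linarith

end Intervals

/-! ### Accurate reward tables -/

variable {K : ℕ} {δ : ℝ} {x : Fin K → ℕ → ℝ} {μ : Fin K → ℝ}

/-- All empirical means of the reward table `x` are within the confidence radius of the means
`μ`. -/
def Accurate (δ : ℝ) (x : Fin K → ℕ → ℝ) (μ : Fin K → ℝ) : Prop :=
  ∀ a n, 1 ≤ n → |empMean (x a) n - μ a| ≤ ciRadius K δ n

theorem ciRadius_nonneg (K : ℕ) (δ : ℝ) (s : ℕ) : 0 ≤ ciRadius K δ s := Real.sqrt_nonneg _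

theorem lowers_mono {T T' : Fin K → ℕ} {a : Fin K} (h : 1 ≤ T a) (hT : T a ≤ T' a) :
    lowers δ x T a ≤ lowers δ x T' a :=
  maxOver_le_maxOver ⟨1, by simpa using h⟩ (Finset.Icc_subset_Icc_right hT) fun _ _ => le_rfl

theorem uppers_anti {T T' : Fin K → ℕ} {a : Fin K} (h : 1 ≤ T a) (hT : T a ≤ T' a) :
    uppers δ x T' a ≤ uppers δ x T a :=
  minOver_le_minOver ⟨1, by simpa using h⟩ (Finset.Icc_subset_Icc_right hT) fun _ _ => le_rfl

theorem Accurate.mem_interval (hx : Accurate δ x μ) {T : Fin K → ℕ} {a : Fin K} (h : 1 ≤ T a) :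
    lowers δ x T a ≤ μ a ∧ μ a ≤ uppers δ x T a := by
  constructor
  · refine maxOver_le ⟨1, by simpa using h⟩ fun s hs => ?_
    have := abs_le.1 (hx a s (Finset.mem_Icc.1 hs).1)
    linarith
  · refine le_minOver ⟨1, by simpa using h⟩ fun s hs => ?_
    have := abs_le.1 (hx a s (Finset.mem_Icc.1 hs).1)
    linarith

theorem Accurate.radius_le (hx : Accurate δ x μ) {T : Fin K → ℕ} {a : Fin K} (h : 1 ≤ T a) {c : ℝ}
    (hc : ciRadius K δ (T a) ≤ c) :
    μ a - 2 * c ≤ lowers δ x T a ∧ uppers δ x T a ≤ μ a + 2 * c := by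
  have hm : T a ∈ Finset.Icc 1 (T a) := Finset.mem_Icc.2 ⟨h, le_rfl⟩
  have h1 := le_maxOver (f := fun s => empMean (x a) s - ciRadius K δ s) hm
  have h2 := minOver_le (f := fun s => empMean (x a) s + ciRadius K δ s) hm
  have h3 := abs_le.1 (hx a _ h)
  simp only [lowers, uppers, lowerBound, upperBound]
  constructor <;> linarith

/-! ### Elimination -/

theorem elimRun_succ (t : ℕ) : elimRun δ x (t + 1) = elimStep δ x (elimRun δ x t) :=
  Function.iterate_succ_apply' _ _ _

theorem elimRun_pulls_succ (t : ℕ) (a : Fin K) :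
    (elimRun δ x (t + 1)).pulls a =
      (elimRun δ x t).pulls a + if a ∈ (elimRun δ x t).next then 1 else 0 := by
  rw [elimRun_succ]; rfl

theorem mem_elimRun_next_succ {t : ℕ} {a : Fin K} :
    a ∈ (elimRun δ x (t + 1)).next ↔ a ∈ (elimRun δ x t).next ∧
      ¬ gapUpper (lowers δ x (elimRun δ x (t + 1)).pulls) (uppers δ x (elimRun δ x (t + 1)).pulls) a
        ≤ gapLower (lowers δ x (elimRun δ x (t + 1)).pulls)
          (uppers δ x (elimRun δ x (t + 1)).pulls) := by
  rw [elimRun_succ]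
  exact Finset.mem_filter

theorem elimRun_pulls_mono (a : Fin K) : Monotone fun t => (elimRun δ x t).pulls a :=
  monotone_nat_of_le_succ fun t => by rw [elimRun_pulls_succ]; exact Nat.le_add_right _ _

theorem elimRun_next_antitone {s t : ℕ} (hst : s ≤ t) {a : Fin K}
    (ha : a ∈ (elimRun δ x t).next) : a ∈ (elimRun δ x s).next := by
  induction t, hst using Nat.le_induction with
  | base => exact ha
  | succ t _ ih => exact ih (mem_elimRun_next_succ.1 ha).1

theorem elimRun_pulls_le (t : ℕ) (a : Fin K) : (elimRun δ x t).pulls a ≤ t := by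
  induction t with
  | zero => exact le_rfl
  | succ t ih =>
    rw [elimRun_pulls_succ]
    split_ifs <;> omega

theorem elimRun_pulls_of_mem {t : ℕ} {a : Fin K} (ha : a ∈ (elimRun δ x t).next) :
    (elimRun δ x t).pulls a = t := by
  induction t with
  | zero => rfl
  | succ t ih =>
    have := (mem_elimRun_next_succ.1 ha).1
    rw [elimRun_pulls_succ, if_pos this, ih this]

theorem one_le_elimRun_pulls {t : ℕ} (ht : 1 ≤ t) (a : Fin K) : 1 ≤ (elimRun δ x t).pulls a := by
  refine le_trans ?_ (elimRun_pulls_mono a ht)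
  have h := elimRun_pulls_succ (δ := δ) (x := x) 0 a
  rw [if_pos (show a ∈ (elimRun δ x 0).next from Finset.mem_univ a)] at h
  exact (Nat.le_add_left _ _).trans_eq h.symm

theorem elimRun_pulls_eq_of_notMem {s t : ℕ} (hst : s ≤ t) {a : Fin K}
    (ha : a ∉ (elimRun δ x s).next) : (elimRun δ x t).pulls a = (elimRun δ x s).pulls a := by
  induction t, hst using Nat.le_induction with
  | base => rfl
  | succ t hst ih =>
    rw [elimRun_pulls_succ, if_neg fun h => ha (elimRun_next_antitone hst h), ih, add_zero]

theorem exists_round_of_notMem {t : ℕ} {a : Fin K} (ha : a ∉ (elimRun δ x t).next) :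
    ∃ s, 1 ≤ s ∧ s ≤ t ∧ a ∉ (elimRun δ x s).next ∧
      gapUpper (lowers δ x (elimRun δ x s).pulls) (uppers δ x (elimRun δ x s).pulls) a ≤
        gapLower (lowers δ x (elimRun δ x s).pulls) (uppers δ x (elimRun δ x s).pulls) := by
  induction t with
  | zero => exact absurd (Finset.mem_univ a) ha
  | succ t ih =>
    by_cases h : a ∈ (elimRun δ x t).next
    · refine ⟨t + 1, by omega, le_rfl, ha, ?_⟩
      by_contra hc
      exact ha (mem_elimRun_next_succ.2 ⟨h, hc⟩)
    · obtain ⟨s, h1, h2, h3⟩ := ih h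
      exact ⟨s, h1, by omega, h3⟩

/-- An arm is deleted as soon as the confidence radius is below its hardness `g`. Here `(q, p)` is
a gap between the means, with `b` above and `b'` below it. -/
theorem notMem_elimRun_next (hx : Accurate δ x μ) (hK : ∀ i : Fin K, ∃ k, k ≠ i) {p q : ℝ}
    (hpq : ∀ i, p ≤ μ i ∨ μ i ≤ q) (hqp : q < p) {b b' : Fin K} (hb : p ≤ μ b) (hb' : μ b' ≤ q)
    {a : Fin K} {g : ℝ} (hg : 8 * g ≤ p - q)
    (hright : (∃ j, 4 * g ≤ μ j - μ a ∧ 8 * g ≤ p - q - (μ j - μ a)) ∨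
      ∀ j, μ j - μ a ≤ p - q - 8 * g)
    (hleft : (∃ j, 4 * g ≤ μ a - μ j ∧ 8 * g ≤ p - q - (μ a - μ j)) ∨
      ∀ j, μ a - μ j ≤ p - q - 8 * g)
    {t : ℕ} (ht : 1 ≤ t) (hc : ciRadius K δ t < g) : a ∉ (elimRun δ x t).next := by
  obtain ⟨t, rfl⟩ : ∃ t', t = t' + 1 := ⟨t - 1, by omega⟩
  rw [mem_elimRun_next_succ, not_and_not_right]
  intro ha
  set T := (elimRun δ x (t + 1)).pulls with hT
  set l := lowers δ x T
  set r := uppers δ x T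
  have hμ : ∀ i, l i ≤ μ i ∧ μ i ≤ r i := fun i => hx.mem_interval (one_le_elimRun_pulls ht i)
  have hact : ∀ i, i ∈ (elimRun δ x t).next →
      μ i - 2 * ciRadius K δ (t + 1) ≤ l i ∧ r i ≤ μ i + 2 * ciRadius K δ (t + 1) := by
    intro i hi
    refine hx.radius_le (one_le_elimRun_pulls ht i) ?_
    rw [elimRun_pulls_succ, if_pos hi, elimRun_pulls_of_mem hi]
  have hdel : ∀ i, i ∉ (elimRun δ x t).next → ∃ l₀ r₀ : Fin K → ℝ,
      (∀ k, l₀ k ≤ μ k ∧ μ k ≤ r₀ k) ∧ (∀ k, l₀ k ≤ l k) ∧ (∀ k, r k ≤ r₀ k) ∧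
      gapUpper l₀ r₀ i ≤ gapLower l r ∧ l₀ i = l i ∧ r₀ i = r i := by
    intro i hi
    obtain ⟨s, hs1, hst, his, hle⟩ := exists_round_of_notMem hi
    have h1 : ∀ k, lowers δ x (elimRun δ x s).pulls k ≤ l k := fun k =>
      lowers_mono (one_le_elimRun_pulls hs1 k) (elimRun_pulls_mono k (by omega))
    have h2 : ∀ k, r k ≤ uppers δ x (elimRun δ x s).pulls k := fun k =>
      uppers_anti (one_le_elimRun_pulls hs1 k) (elimRun_pulls_mono k (by omega))
    have h3 : T i = (elimRun δ x s).pulls i := elimRun_pulls_eq_of_notMem (by omega) his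
    exact ⟨_, _, fun k => hx.mem_interval (one_le_elimRun_pulls hs1 k), h1, h2,
      hle.trans (gapLower_mono h1 h2), congrArg (lowerBound K δ (x i)) h3.symm,
      congrArg (upperBound K δ (x i)) h3.symm⟩
  have hc0 := ciRadius_nonneg K δ (t + 1)
  have hDL : p - q - 4 * ciRadius K δ (t + 1) ≤ gapLower l r := by
    by_contra hcon
    have := sub_le_gapLower (l := l) (r := r) (S := Finset.univ.filter fun i => p ≤ μ i)
      (A := p - 2 * ciRadius K δ (t + 1)) (B := q + 2 * ciRadius K δ (t + 1))
      ⟨b, by simpa using hb⟩ ⟨b', by simpa using hb'.trans_lt hqp⟩ (fun i hi => ?_)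
      (fun i hi => ?_)
    · linarith
    · -- an arm above the gap is not deleted before its lower end exceeds `p`
      simp only [Finset.mem_filter, Finset.mem_univ, true_and] at hi
      by_cases h : i ∈ (elimRun δ x t).next
      · have := hact i h
        linarith
      · obtain ⟨l₀, r₀, h0, -, -, h3, h4, -⟩ := hdel i h
        by_contra hlt
        have := le_gapUpper_of_upper h0 hpq hi (by linarith)
          (b := b') (by rintro rfl; linarith) hb'
        linarith
    · simp only [Finset.mem_filter, Finset.mem_univ, true_and] at hi
      have hi := (hpq i).resolve_left hi
      by_cases h : i ∈ (elimRun δ x t).next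
      · have := hact i h
        linarith
      · obtain ⟨l₀, r₀, h0, -, -, h3, -, h4⟩ := hdel i h
        by_contra hlt
        have := le_gapUpper_of_lower h0 hpq hi (by linarith)
          (b := b) (by rintro rfl; linarith) hb
        linarith
  exact gapUpper_le_of_active (act := fun i => i ∈ (elimRun δ x t).next) hc0 hc hg hDL hμ hact
    (fun i hi => by
      obtain ⟨l₀, r₀, -, h⟩ := hdel i hi
      exact ⟨l₀, r₀, h⟩) hK ha hright hleft

theorem elimRun_pulls_le_of_notMem {N : ℕ} {a : Fin K} (h : a ∉ (elimRun δ x N).next) (t : ℕ) :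
    (elimRun δ x t).pulls a ≤ N := by
  rcases le_total t N with ht | ht
  · exact (elimRun_pulls_le t a).trans ht
  · rw [elimRun_pulls_eq_of_notMem ht h]
    exact elimRun_pulls_le N a

/-- If every arm `a` other than `b` and `b'` is inactive after `N a` rounds, the algorithm stops,
and it stops early enough. -/
theorem exists_elimStopsAt {b b' : Fin K} {S : Finset (Fin K)} (hS : S = Finset.univ \ {b, b'})
    (hSne : S.Nonempty) {N : Fin K → ℕ} (hN1 : ∀ a ∈ S, 1 ≤ N a)
    (hN : ∀ a ∈ S, a ∉ (elimRun δ x (N a)).next) :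
    ∃ τ, ElimStopsAt δ x τ ∧ (∀ a ∈ S, (elimRun δ x τ).pulls a ≤ N a) ∧
      ∑ a, (elimRun δ x τ).pulls a ≤ 3 * ∑ a ∈ S, N a := by
  obtain ⟨a₀, ha₀, hmax⟩ := Finset.exists_max_image S N hSne
  have hfew : 1 ≤ N a₀ ∧ (elimRun δ x (N a₀)).next.card ≤ 2 := by
    refine ⟨hN1 _ ha₀, ?_⟩
    refine (Finset.card_le_card (t := {b, b'}) fun a ha => ?_).trans Finset.card_le_two
    by_contra hab
    have haS : a ∈ S := by rw [hS]; simpa using hab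
    exact hN a haS (elimRun_next_antitone (hmax a haS) ha)
  have hex : ∃ t, 1 ≤ t ∧ (elimRun δ x t).next.card ≤ 2 := ⟨_, hfew⟩
  classical
  refine ⟨Nat.find hex, ⟨Nat.find_spec hex, fun t ht => Nat.find_min' hex ht⟩,
    fun a ha => elimRun_pulls_le_of_notMem (hN a ha) _, ?_⟩
  have hτ : Nat.find hex ≤ N a₀ := Nat.find_min' hex hfew
  have hN₀ : N a₀ ≤ ∑ a ∈ S, N a := Finset.single_le_sum (fun _ _ => Nat.zero_le _) ha₀
  rw [← Finset.sum_sdiff (Finset.subset_univ {b, b'}), ← hS]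
  have h1 : ∑ a ∈ S, (elimRun δ x (Nat.find hex)).pulls a ≤ ∑ a ∈ S, N a :=
    Finset.sum_le_sum fun a ha => elimRun_pulls_le_of_notMem (hN a ha) _
  have h2 : ∑ a ∈ {b, b'}, (elimRun δ x (Nat.find hex)).pulls a ≤ 2 * N a₀ :=
    calc ∑ a ∈ {b, b'}, (elimRun δ x (Nat.find hex)).pulls a
        ≤ ({b, b'} : Finset (Fin K)).card • N a₀ :=
          Finset.sum_le_card_nsmul _ _ _ fun a _ => (elimRun_pulls_le _ a).trans hτ
      _ ≤ 2 * N a₀ := Nat.mul_le_mul_right _ Finset.card_le_two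
  omega

/-! ### Upper confidence bounds -/

/-- `R` is a set of rounds in which the well-sampled arm `a` has a gap bound of at least `D`,
attained to its right, and `T s i` counts at least the earlier rounds of `R` in which the gap bound
of `i` was no smaller than that of `a`. Then `R` has at most `N` elements: some arm reaches across
the gap in the last round of `R`, its gap bound was no smaller than that of `a` in all earlier ones,
and its interval is too wide for an arm sampled `N` times. This arm is one in the
middle of the window of length `D` above `a`, if there is one; if `a` has the largest mean, any arm
that reaches across the gap in the last round will do. -/
theorem card_rightRounds_le {R : Finset ℕ} {l r : ℕ → Fin K → ℝ} {T : ℕ → Fin K → ℕ} {a : Fin K}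
    {N : ℕ} {c g D : ℝ} (hK : ∀ i : Fin K, ∃ k, k ≠ i) (hc : 0 ≤ c) (hcg : 4 * c < g) (hgD : g ≤ D)
    (hr : ∀ s ∈ R, ∀ s' ∈ R, s' ≤ s → ∀ i, r s i ≤ r s' i)
    (hμ : ∀ s ∈ R, ∀ i, l s i ≤ μ i ∧ μ i ≤ r s i)
    (hrad : ∀ s ∈ R, ∀ i, N ≤ T s i → μ i - 2 * c ≤ l s i ∧ r s i ≤ μ i + 2 * c)
    (hcount : ∀ s ∈ R, ∀ i, ∀ Q ⊆ R, (∀ s' ∈ Q, s' < s ∧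
      gapUpper (l s') (r s') a ≤ gapUpper (l s') (r s') i) → Q.card ≤ T s i)
    (hT : ∀ s ∈ R, N ≤ T s a) (hD : ∀ s ∈ R, D ≤ gapUpper (l s) (r s) a)
    (hR : ∀ s ∈ R, ∃ j, l s a ≤ l s j ∧ l s j ≤ r s a ∧
      gapUpper (l s) (r s) a = rightGapAt (l s) (r s) a (l s j))
    (hcond : (∃ j, g ≤ μ j - μ a ∧ g ≤ D - (μ j - μ a)) ∨ ∀ j, μ j ≤ μ a) : R.card ≤ N := by
  by_contra hcon
  have hRne : R.Nonempty := Finset.card_pos.1 (by omega)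
  set s := R.max' hRne with hs
  have hsR : s ∈ R := R.max'_mem hRne
  -- an arm that is sampled in all earlier rounds of `R` has a short interval in the last one
  have key : ∀ i, (∀ s' ∈ R, gapUpper (l s') (r s') a ≤ gapUpper (l s') (r s') i) →
      μ i - 2 * c ≤ l s i ∧ r s i ≤ μ i + 2 * c := by
    intro i hi
    refine hrad s hsR i (le_trans ?_ (hcount s hsR i (R.erase s) (Finset.erase_subset _ _) ?_))
    · rw [Finset.card_erase_of_mem hsR]; omega
    · intro s' hs'
      obtain ⟨h1, h2⟩ := Finset.mem_erase.1 hs'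
      exact ⟨lt_of_le_of_ne (R.le_max' s' h2) h1, hi s' h2⟩
  obtain ⟨j, hj1, hj2, hj3⟩ := hR s hsR
  have hDs := hD s hsR
  obtain ⟨ha1, ha2⟩ := hrad s hsR a (hT s hsR)
  rcases hcond with ⟨i, hi1, hi2⟩ | htop
  · obtain ⟨hi3, hi4⟩ := key i fun s' hs' => by
      obtain ⟨j', hj1', hj2', hj3'⟩ := hR s' hs'
      have := hrad s' hs' a (hT s' hs')
      have := hμ s' hs' i
      have := hD s' hs'
      rw [hj3'] at this ⊢
      exact rightGapAt_le_gapUpper_of_meets (by linarith) (by linarith) (by linarith) (hK i) (hK a)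
    obtain ⟨k, -, hk, e⟩ := rightGapAt_of_nonempty (l := l s) (r := r s) (a := a) (x := l s j)
      ⟨i, by linarith⟩
    have := hk i (by linarith)
    linarith
  · obtain ⟨i, hi⟩ : ∃ i, l s j + D ≤ r s i := by
      by_cases hne : ∃ k, l s j < l s k
      · obtain ⟨k, -, -, e⟩ := rightGapAt_of_nonempty (r := r s) (a := a) hne
        exact ⟨k, by linarith⟩
      · push Not at hne
        obtain ⟨k₀, hk₀⟩ := hK a
        obtain ⟨k, -, e⟩ := exists_maxOver_eq (f := r s) (s := Finset.univ.erase a)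
          ⟨k₀, by simpa using hk₀⟩
        rw [hj3, rightGapAt_of_empty hne, e] at hDs
        exact ⟨k, by linarith⟩
    have := key i fun s' hs' => by
      obtain ⟨j', hj1', hj2', hj3'⟩ := hR s' hs'
      have := hrad s' hs' a (hT s' hs')
      have := hμ s' hs' i
      have := hD s' hs'
      have := hr s hsR s' hs' (R.le_max' s' hs') i
      have := htop i
      rw [hj3'] at *
      exact rightGapAt_le_gapUpper_of_meets (by linarith) (by linarith) (by linarith) (hK i) (hK a)
    have := htop i
    linarith

theorem ucbRun_succ (t : ℕ) : ucbRun δ x (t + 1) = ucbStep δ x (ucbRun δ x t) :=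
  Function.iterate_succ_apply' _ _ _

theorem ucbRun_pulls_succ (t : ℕ) (a : Fin K) :
    (ucbRun δ x (t + 1)).pulls a =
      (ucbRun δ x t).pulls a + if a ∈ (ucbRun δ x t).next then 1 else 0 := by
  rw [ucbRun_succ]; rfl

theorem mem_ucbRun_next {t : ℕ} (ht : 1 ≤ t) {a : Fin K} :
    a ∈ (ucbRun δ x t).next ↔
      gapUpper (lowers δ x (ucbRun δ x t).pulls) (uppers δ x (ucbRun δ x t).pulls) a =
        maxOver Finset.univ
          (gapUpper (lowers δ x (ucbRun δ x t).pulls) (uppers δ x (ucbRun δ x t).pulls)) := by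
  obtain ⟨t, rfl⟩ : ∃ t', t = t' + 1 := ⟨t - 1, by omega⟩
  rw [ucbRun_succ]
  simp [ucbStep]

theorem ucbRun_pulls_mono (a : Fin K) : Monotone fun t => (ucbRun δ x t).pulls a :=
  monotone_nat_of_le_succ fun t => by rw [ucbRun_pulls_succ]; exact Nat.le_add_right _ _

theorem one_le_ucbRun_pulls {t : ℕ} (ht : 1 ≤ t) (a : Fin K) : 1 ≤ (ucbRun δ x t).pulls a := by
  refine le_trans ?_ (ucbRun_pulls_mono a ht)
  have h := ucbRun_pulls_succ (δ := δ) (x := x) 0 a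
  rw [if_pos (show a ∈ (ucbRun δ x 0).next from Finset.mem_univ a)] at h
  exact (Nat.le_add_left _ _).trans_eq h.symm

theorem ucbRun_pulls_eq_card (t : ℕ) (a : Fin K) :
    (ucbRun δ x t).pulls a = ((Finset.range t).filter fun s => a ∈ (ucbRun δ x s).next).card := by
  induction t with
  | zero => rfl
  | succ t ih =>
    rw [ucbRun_pulls_succ, ih, Finset.range_add_one, Finset.filter_insert]
    split_ifs
    · rw [Finset.card_insert_of_notMem (by simp)]
    · rfl

/-- An arm of hardness `g` is sampled at most `3 * N` times if `N` samples bring the confidence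
radius below `g / 4`: at most `N` times before that, and then at most `N` times for the gap on
either side of it. -/
theorem ucbRun_pulls_le (hx : Accurate δ x μ) (hK : ∀ i : Fin K, ∃ k, k ≠ i) {p q : ℝ}
    (hpq : ∀ i, p ≤ μ i ∨ μ i ≤ q) {b b' : Fin K} (hb : μ b = p) (hb' : μ b' ≤ q) (hbb : b' ≠ b)
    {a : Fin K} {g c : ℝ} (hc : 0 ≤ c) (hcg : 4 * c < g) (hg : g ≤ p - q)
    (hright : (∃ j, g ≤ μ j - μ a ∧ g ≤ p - q - (μ j - μ a)) ∨ ∀ j, μ j ≤ μ a)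
    (hleft : (∃ j, g ≤ μ a - μ j ∧ g ≤ p - q - (μ a - μ j)) ∨ ∀ j, μ a ≤ μ j)
    {N : ℕ} (hN1 : 1 ≤ N) (hN : ∀ s, N ≤ s → ciRadius K δ s ≤ c) (t : ℕ) :
    (ucbRun δ x t).pulls a ≤ 3 * N := by
  classical
  set T := fun s => (ucbRun δ x s).pulls with hT
  set l := fun s => lowers δ x (T s) with hl
  set r := fun s => uppers δ x (T s) with hr
  set W := fun t => (Finset.range t).filter fun s => a ∈ (ucbRun δ x s).next ∧ N ≤ T s a with hW
  set A := fun s => ∃ j, l s a ≤ l s j ∧ l s j ≤ r s a ∧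
      gapUpper (l s) (r s) a = rightGapAt (l s) (r s) a (l s j) with hA
  set B := fun s => ∃ j, l s a ≤ r s j ∧ r s j ≤ r s a ∧
      gapUpper (l s) (r s) a = leftGapAt (l s) (r s) a (r s j) with hB
  have hW1 : ∀ s ∈ W t, 1 ≤ s := by
    intro s hs
    rcases Nat.eq_zero_or_pos s with rfl | h
    · have : N ≤ 0 := (Finset.mem_filter.1 hs).2.2
      omega
    · exact h
  have hμ : ∀ s ∈ W t, ∀ i, l s i ≤ μ i ∧ μ i ≤ r s i := fun s hs i =>
    hx.mem_interval (one_le_ucbRun_pulls (hW1 s hs) i)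
  have hrad : ∀ s ∈ W t, ∀ i, N ≤ T s i → μ i - 2 * c ≤ l s i ∧ r s i ≤ μ i + 2 * c :=
    fun s hs i hi => hx.radius_le (one_le_ucbRun_pulls (hW1 s hs) i) (hN _ hi)
  have hmax : ∀ s ∈ W t, ∀ i, gapUpper (l s) (r s) i ≤ gapUpper (l s) (r s) a := fun s hs i => by
    rw [(mem_ucbRun_next (hW1 s hs)).1 (Finset.mem_filter.1 hs).2.1]
    exact le_maxOver (Finset.mem_univ i)
  have hcount : ∀ s ∈ W t, ∀ i, ∀ Q ⊆ W t, (∀ s' ∈ Q, s' < s ∧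
      gapUpper (l s') (r s') a ≤ gapUpper (l s') (r s') i) → Q.card ≤ T s i := by
    intro s hs i Q hQ h
    simp only [hT]
    rw [ucbRun_pulls_eq_card]
    refine Finset.card_le_card fun s' hs' => ?_
    have h1 := hQ hs'
    refine Finset.mem_filter.2 ⟨Finset.mem_range.2 (h s' hs').1, ?_⟩
    rw [mem_ucbRun_next (hW1 s' h1), ← (mem_ucbRun_next (hW1 s' h1)).1 (Finset.mem_filter.1 h1).2.1]
    exact le_antisymm (hmax s' h1 i) (h s' hs').2
  have hD : ∀ s ∈ W t, p - q ≤ gapUpper (l s) (r s) a := fun s hs =>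
    (le_gapUpper_of_upper (hμ s hs) hpq hb.ge (hb ▸ (hμ s hs b).1) hbb hb').trans (hmax s hs b)
  have hTa : ∀ s ∈ W t, N ≤ T s a := fun s hs => (Finset.mem_filter.1 hs).2.2
  have hAcard : ((W t).filter A).card ≤ N := by
    have hm : ∀ s ∈ (W t).filter A, s ∈ W t := fun s hs => (Finset.mem_filter.1 hs).1
    refine card_rightRounds_le hK hc hcg hg ?_ (fun s hs => hμ s (hm s hs))
      (fun s hs => hrad s (hm s hs))
      (fun s hs i Q hQ => hcount s (hm s hs) i Q (hQ.trans (Finset.filter_subset _ _)))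
      (fun s hs => hTa s (hm s hs)) (fun s hs => hD s (hm s hs))
      (fun s hs => (Finset.mem_filter.1 hs).2) hright
    exact fun s hs s' hs' hss i => uppers_anti (one_le_ucbRun_pulls (hW1 s' (hm s' hs')) i)
      (ucbRun_pulls_mono i hss)
  have hBcard : ((W t).filter B).card ≤ N := by
    have hm : ∀ s ∈ (W t).filter B, s ∈ W t := fun s hs => (Finset.mem_filter.1 hs).1
    refine card_rightRounds_le (l := fun s i => -r s i) (r := fun s i => -l s i)
      (μ := fun i => -μ i) (T := T) (a := a) hK hc hcg hg ?_
      (fun s hs i => ⟨neg_le_neg (hμ s (hm s hs) i).2, neg_le_neg (hμ s (hm s hs) i).1⟩)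
      (fun s hs i hi => ?_) (fun s hs i Q hQ => ?_)
      (fun s hs => hTa s (hm s hs)) (fun s hs => ?_)
      (fun s hs => ?_) ?_
    · exact fun s hs s' hs' hss i => neg_le_neg <|
        lowers_mono (one_le_ucbRun_pulls (hW1 s' (hm s' hs')) i) (ucbRun_pulls_mono i hss)
    · have := hrad s (hm s hs) i hi
      constructor <;> linarith
    · simp only [gapUpper_neg]
      exact hcount s (hm s hs) i Q (hQ.trans (Finset.filter_subset _ _))
    · rw [gapUpper_neg]
      exact hD s (hm s hs)
    · obtain ⟨j, h1, h2, h3⟩ := (Finset.mem_filter.1 hs).2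
      exact ⟨j, neg_le_neg h2, neg_le_neg h1, by rw [gapUpper_neg, rightGapAt_neg, h3]⟩
    · have e : ∀ j, -μ j - -μ a = μ a - μ j := fun j => by ring
      simpa only [e, neg_le_neg_iff] using hleft
  -- only the samples of `a` beyond the first `N` are counted by `W`
  have hsplit : ∀ t, T t a ≤ N + (W t).card := by
    intro t
    induction t with
    | zero => exact Nat.zero_le _
    | succ t ih =>
      have h1 : T (t + 1) a = T t a + if a ∈ (ucbRun δ x t).next then 1 else 0 :=
        ucbRun_pulls_succ t a
      have h2 : W (t + 1) =
          if a ∈ (ucbRun δ x t).next ∧ N ≤ T t a then insert t (W t) else W t := by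
        simp only [hW]
        rw [Finset.range_add_one, Finset.filter_insert]
      by_cases h : a ∈ (ucbRun δ x t).next
      · by_cases h' : N ≤ T t a
        · rw [h1, h2, if_pos h, if_pos ⟨h, h'⟩, Finset.card_insert_of_notMem (by simp [hW])]
          omega
        · rw [h1, if_pos h]
          omega
      · rw [h1, h2, if_neg h, if_neg fun h' => h h'.1]
        exact ih
  have hAB : W t ⊆ (W t).filter A ∪ (W t).filter B := by
    intro s hs
    rw [← Finset.filter_or, Finset.mem_filter]
    exact ⟨hs, gapUpper_eq ((hμ s hs a).1.trans (hμ s hs a).2)⟩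
  have h1 := Finset.card_le_card hAB
  have h2 := Finset.card_union_le ((W t).filter A) ((W t).filter B)
  have h3 := hsplit t
  simp only [hT] at h3
  omega

/-- If the arms other than `b` and `b'` are together sampled at most `M` times, the algorithm stops:
before the last round `b` and `b'` were sampled at most `c * M` times, and the last round adds at
most two samples of them. -/
theorem exists_ucbStopsAt {b b' : Fin K} (hbb : b ≠ b') {c M : ℝ} (hc : 0 < c)
    {S : Finset (Fin K)} (hS : S = Finset.univ \ {b, b'})
    (hM : ∀ t, ∑ a ∈ S, ((ucbRun δ x t).pulls a : ℝ) ≤ M) :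
    ∃ τ, UCBStopsAt c δ x τ ∧ ∑ a, ((ucbRun δ x τ).pulls a : ℝ) ≤ (1 + c) * M + 2 := by
  have hsum : ∀ t, ∑ a, ((ucbRun δ x t).pulls a : ℝ) = ∑ a ∈ S, ((ucbRun δ x t).pulls a : ℝ) +
      ((ucbRun δ x t).pulls b + (ucbRun δ x t).pulls b') := fun t => by
    rw [← Finset.sum_sdiff (Finset.subset_univ {b, b'}), ← hS, Finset.sum_pair hbb]
  have hM0 : 0 ≤ M := (Finset.sum_nonneg fun _ _ => Nat.cast_nonneg _).trans (hM 0)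
  have hrun : ∀ t, ¬ ucbStopCond c (ucbRun δ x t).pulls →
      ((ucbRun δ x t).pulls b + (ucbRun δ x t).pulls b' : ℝ) ≤ c * M := by
    intro t ht
    have h : ((ucbRun δ x t).pulls b + (ucbRun δ x t).pulls b' : ℝ) <
        c * ∑ a ∈ S, ((ucbRun δ x t).pulls a : ℝ) := by
      by_contra h
      exact ht ⟨b, b', hbb, by rw [← hS]; exact not_lt.1 h⟩
    exact h.le.trans (mul_le_mul_of_nonneg_left (hM t) hc.le)
  -- every round takes at least one sample
  have hgrow : ∀ t : ℕ, (t : ℝ) ≤ ∑ a, ((ucbRun δ x t).pulls a : ℝ) := by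
    intro t
    induction t with
    | zero => exact_mod_cast Nat.zero_le _
    | succ t ih =>
      obtain ⟨a, ha⟩ : ∃ a, a ∈ (ucbRun δ x t).next := by
        rcases Nat.eq_zero_or_pos t with rfl | ht
        · exact ⟨b, Finset.mem_univ b⟩
        · obtain ⟨a, -, e⟩ := exists_maxOver_eq (s := Finset.univ)
            (f := gapUpper (lowers δ x (ucbRun δ x t).pulls) (uppers δ x (ucbRun δ x t).pulls))
            ⟨b, Finset.mem_univ b⟩
          exact ⟨a, (mem_ucbRun_next ht).2 e.symm⟩
      have h1 : ∑ a, ((ucbRun δ x t).pulls a : ℝ) + 1 ≤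
          ∑ a, ((ucbRun δ x (t + 1)).pulls a : ℝ) := by
        exact_mod_cast Finset.sum_lt_sum (fun i _ => ucbRun_pulls_mono i t.le_succ)
          ⟨a, Finset.mem_univ a, by
            have := ucbRun_pulls_succ (δ := δ) (x := x) t a
            rw [if_pos ha] at this
            exact (Nat.lt_succ_self _).trans_eq this.symm⟩
      push_cast
      linarith
  have hex : ∃ t, 1 ≤ t ∧ ucbStopCond c (ucbRun δ x t).pulls := by
    obtain ⟨t, ht⟩ := exists_nat_gt ((1 + c) * M)
    refine ⟨t, ?_, ?_⟩
    · have : (0 : ℝ) < t := lt_of_le_of_lt (by positivity) ht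
      exact_mod_cast this
    · by_contra h
      have := hrun t h
      have := hgrow t
      have := hM t
      have := hsum t
      linarith
  classical
  refine ⟨Nat.find hex, ⟨Nat.find_spec hex, fun t ht => Nat.find_min' hex ht⟩, ?_⟩
  obtain ⟨τ, hτ⟩ : ∃ τ, Nat.find hex = τ + 1 :=
    ⟨Nat.find hex - 1, by have := (Nat.find_spec hex).1; omega⟩
  rw [hτ, hsum]
  have hstep : ∀ i, ((ucbRun δ x (τ + 1)).pulls i : ℝ) ≤ (ucbRun δ x τ).pulls i + 1 := fun i => by
    rw [ucbRun_pulls_succ]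
    split_ifs <;> simp
  have h1 := hstep b
  have h2 := hstep b'
  have h3 : ((ucbRun δ x τ).pulls b + (ucbRun δ x τ).pulls b' : ℝ) ≤ c * M := by
    rcases Nat.eq_zero_or_pos τ with rfl | hpos
    · have e : ∀ i, (ucbRun δ x 0).pulls i = 0 := fun i => rfl
      rw [e, e]
      simpa using mul_nonneg hc.le hM0
    · refine hrun τ fun h => ?_
      have := Nat.find_min' hex ⟨hpos, h⟩
      omega
  have h4 := hM (τ + 1)
  linarith

/-! ### The gaps between the sorted means -/

theorem rankedArm_antitone {i j : Fin K} (h : i ≤ j) :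
    μ (rankedArm μ j) ≤ μ (rankedArm μ i) :=
  neg_le_neg_iff.1 (Tuple.monotone_sort (fun a => -μ a) h)

theorem adjGap_nonneg (j : Fin (K - 1)) : 0 ≤ adjGap μ j :=
  sub_nonneg.2 (rankedArm_antitone (Fin.mk_le_mk.2 (Nat.le_succ _)))

theorem UniqueMaxGap.deltaMax_eq {m : Fin (K - 1)} (h : UniqueMaxGap μ m) :
    deltaMax μ = μ (upperArm μ m) - μ (lowerArm μ m) := by
  refine le_antisymm (maxOver_le ⟨m, Finset.mem_univ m⟩ fun j _ => ?_)
    (le_maxOver (f := adjGap μ) (Finset.mem_univ m))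
  by_cases hj : j = m
  · rw [hj]; exact le_rfl
  · exact (h.gap_lt j hj).le

theorem UniqueMaxGap.lower_lt_upper {m : Fin (K - 1)} (h : UniqueMaxGap μ m) (hK : 3 ≤ K) :
    μ (lowerArm μ m) < μ (upperArm μ m) := by
  obtain ⟨j, hj⟩ : ∃ j : Fin (K - 1), j ≠ m := by
    have : Nontrivial (Fin (K - 1)) := Fin.nontrivial_iff_two_le.2 (by omega)
    exact exists_ne m
  exact sub_pos.1 ((adjGap_nonneg j).trans_lt (h.gap_lt j hj))

theorem upper_le_or_le_lower (m : Fin (K - 1)) (a : Fin K) :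
    μ (upperArm μ m) ≤ μ a ∨ μ a ≤ μ (lowerArm μ m) := by
  obtain ⟨k, rfl⟩ := (rankedArm μ).surjective a
  rcases le_or_gt k.1 m.1 with h | h
  · exact .inl (rankedArm_antitone (Fin.le_def.2 h))
  · exact .inr (rankedArm_antitone (Fin.le_def.2 h))

/-- A suboptimal arm with arms above it has an arm above it at a distance below the largest gap:
otherwise the gap just above it would be a largest one. -/
theorem UniqueMaxGap.exists_close_above {m : Fin (K - 1)} (h : UniqueMaxGap μ m) {a : Fin K}
    (ha : a ∈ suboptimal μ m) (hj : ∃ j, 0 < μ j - μ a) :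
    ∃ j, 0 < μ j - μ a ∧ μ j - μ a < deltaMax μ := by
  obtain ⟨i, rfl⟩ := (rankedArm μ).surjective a
  have hne : (Finset.univ.filter fun k => μ (rankedArm μ i) < μ (rankedArm μ k)).Nonempty := by
    obtain ⟨j, hj⟩ := hj
    exact ⟨(rankedArm μ).symm j, by simpa using hj⟩
  obtain ⟨k, hk, hmax⟩ := Finset.exists_max_image _ id hne
  simp only [Finset.mem_filter, Finset.mem_univ, true_and, id_eq] at hk hmax
  have hki : k < i := by
    by_contra hik
    exact absurd (rankedArm_antitone (μ := μ) (not_lt.1 hik)) (not_le.2 hk)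
  have hki' := Fin.lt_def.1 hki
  have hi := i.2
  refine ⟨rankedArm μ k, sub_pos.2 hk, ?_⟩
  have heq : μ (rankedArm μ ⟨k.1 + 1, by omega⟩) = μ (rankedArm μ i) := by
    refine le_antisymm (not_lt.1 fun hlt => ?_) (rankedArm_antitone (Fin.le_def.2 hki'))
    exact absurd (Fin.le_def.1 (hmax _ hlt)) (by simp)
  have hgap : μ (rankedArm μ k) - μ (rankedArm μ i) = adjGap μ ⟨k.1, by omega⟩ := by
    rw [← heq]; rfl
  rw [hgap, h.deltaMax_eq]
  refine h.gap_lt _ fun hkm => ?_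
  have : lowerArm μ m = rankedArm μ ⟨k.1 + 1, by omega⟩ := by rw [← hkm]; rfl
  have := h.lower_unique (rankedArm μ i) (by rw [this, heq])
  simp [suboptimal, this] at ha

theorem UniqueMaxGap.exists_close_below {m : Fin (K - 1)} (h : UniqueMaxGap μ m) {a : Fin K}
    (ha : a ∈ suboptimal μ m) (hj : ∃ j, 0 < μ a - μ j) :
    ∃ j, 0 < μ a - μ j ∧ μ a - μ j < deltaMax μ := by
  obtain ⟨i, rfl⟩ := (rankedArm μ).surjective a
  have hne : (Finset.univ.filter fun k => μ (rankedArm μ k) < μ (rankedArm μ i)).Nonempty := by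
    obtain ⟨j, hj⟩ := hj
    exact ⟨(rankedArm μ).symm j, by simpa using hj⟩
  obtain ⟨k, hk, hmin⟩ := Finset.exists_min_image _ id hne
  simp only [Finset.mem_filter, Finset.mem_univ, true_and, id_eq] at hk hmin
  have hki : i < k := by
    by_contra hik
    exact absurd (rankedArm_antitone (μ := μ) (not_lt.1 hik)) (not_le.2 hk)
  have hki' := Fin.lt_def.1 hki
  have hk2 := k.2
  refine ⟨rankedArm μ k, sub_pos.2 hk, ?_⟩
  have heq : μ (rankedArm μ ⟨k.1 - 1, by omega⟩) = μ (rankedArm μ i) := by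
    refine le_antisymm (rankedArm_antitone (Fin.le_def.2 (by simp; omega)))
      (not_lt.1 fun hlt => ?_)
    exact absurd (Fin.le_def.1 (hmin _ hlt)) (by simp; omega)
  have hsucc : (⟨k.1 - 1 + 1, by omega⟩ : Fin K) = k := Fin.ext (by simp; omega)
  have hgap : μ (rankedArm μ i) - μ (rankedArm μ k) = adjGap μ ⟨k.1 - 1, by omega⟩ := by
    rw [← heq, adjGap, upperArm, lowerArm, hsucc]
  rw [hgap, h.deltaMax_eq]
  refine h.gap_lt _ fun hkm => ?_
  have : upperArm μ m = rankedArm μ ⟨k.1 - 1, by omega⟩ := by rw [← hkm]; rfl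
  have := h.upper_unique (rankedArm μ i) (by rw [this, heq])
  simp [suboptimal, this] at ha

/-! ### One-sided hardness -/

section Sides

variable {ι : Type*} {s : Finset ι} {f : ι → ℝ}

theorem coe_le_maxOrTop {g : ℝ} : (g : EReal) ≤ maxOrTop s f ↔ s = ∅ ∨ ∃ i ∈ s, g ≤ f i := by
  rw [maxOrTop]
  split_ifs with h
  · rw [EReal.coe_le_coe_iff]
    constructor
    · intro hg
      obtain ⟨i, hi, e⟩ := exists_maxOver_eq (f := f) h
      exact .inr ⟨i, hi, e ▸ hg⟩
    · rintro (h' | ⟨i, hi, hg⟩)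
      · exact absurd h' h.ne_empty
      · exact hg.trans (le_maxOver hi)
  · simp [Finset.not_nonempty_iff_eq_empty.1 h]

theorem maxOrTop_ne_top (h : s.Nonempty) : maxOrTop s f ≠ ⊤ := by
  rw [maxOrTop, if_pos h]
  exact EReal.coe_ne_top _

theorem maxOrTop_pos (h : ∀ i ∈ s, 0 < f i) : 0 < maxOrTop s f := by
  rw [maxOrTop]
  split_ifs with hs
  · obtain ⟨i, hi, e⟩ := exists_maxOver_eq (f := f) hs
    rw [e]
    exact EReal.coe_pos.2 (h i hi)
  · exact EReal.zero_lt_top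

variable {d : Fin K → ℝ} {D e g : ℝ}

/-- For `d j = μ j - μ a` and `d j = μ a - μ j` the maximum is `gammaRight μ a` and `gammaLeft μ a`.
By `hd` the maximum is over the empty set only if no arm lies on the side in question. -/
theorem exists_or_forall_of_le_gammaSide
    (hd : (∃ j, 0 < d j) → ∃ j, 0 < d j ∧ d j < D)
    (hg : (g : EReal) ≤ maxOrTop (Finset.univ.filter fun j => 0 < d j ∧ d j < D)
      fun j => min (d j) (D - d j)) :
    (∃ j, g ≤ d j ∧ g ≤ D - d j) ∨ ∀ j, d j ≤ 0 := by
  rcases coe_le_maxOrTop.1 hg with h | ⟨j, -, hj⟩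
  · refine .inr fun j => not_lt.1 fun hj => ?_
    obtain ⟨i, hi⟩ := hd ⟨j, hj⟩
    exact Finset.notMem_empty i (h ▸ by simpa using hi)
  · exact .inl ⟨j, le_min_iff.1 hj⟩

theorem gammaSide_pos : 0 < maxOrTop (Finset.univ.filter fun j => 0 < d j ∧ d j < D)
    fun j => min (d j) (D - d j) := by
  refine maxOrTop_pos fun i hi => ?_
  simp only [Finset.mem_filter, Finset.mem_univ, true_and] at hi
  exact lt_min hi.1 (sub_pos.2 hi.2)

theorem gammaSide_ne_top (hd : (∃ j, 0 < d j) → ∃ j, 0 < d j ∧ d j < D) (h : ∃ j, 0 < d j) :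
    maxOrTop (Finset.univ.filter fun j => 0 < d j ∧ d j < D) (fun j => min (d j) (D - d j)) ≠
      ⊤ := by
  obtain ⟨j, hj⟩ := hd h
  exact maxOrTop_ne_top ⟨j, by simpa using hj⟩

/-- For `d j = μ j - μ a` and `d j = μ a - μ j`, with `e` the distance to the extreme arm on that
side, the maximum is `rhoRight μ a` and `rhoLeft μ a`. -/
theorem coe_div_le_rhoSide (hg' : 0 < g)
    (hg : (∃ j, g ≤ d j ∧ g ≤ D - d j) ∨ ∀ j, d j ≤ 0) :
    ((g / 8 : ℝ) : EReal) ≤ max (maxOrTop (Finset.univ.filter fun j => 0 < d j)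
      fun j => min (d j / 4) ((D - d j) / 8)) (((D - e) / 8 : ℝ) : EReal) := by
  refine le_max_of_le_left (coe_le_maxOrTop.2 ?_)
  rcases hg with ⟨j, h1, h2⟩ | h
  · refine .inr ⟨j, by simpa using hg'.trans_le h1, le_min ?_ ?_⟩ <;> linarith
  · refine .inl (Finset.filter_eq_empty_iff.2 fun j _ => not_lt.2 (h j))

theorem rhoSide_ne_top (h : ∃ j, 0 < d j) :
    max (maxOrTop (Finset.univ.filter fun j => 0 < d j)
      fun j => min (d j / 4) ((D - d j) / 8)) (((D - e) / 8 : ℝ) : EReal) ≠ ⊤ := by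
  obtain ⟨j, hj⟩ := h
  exact (max_lt (lt_top_iff_ne_top.2 (maxOrTop_ne_top ⟨j, by simpa using hj⟩))
    (EReal.coe_lt_top _)).ne

theorem exists_or_forall_of_le_rhoSide (hgD : 8 * g ≤ D) (he : ∀ j, d j ≤ e)
    (hg : (g : EReal) ≤ max (maxOrTop (Finset.univ.filter fun j => 0 < d j)
      fun j => min (d j / 4) ((D - d j) / 8)) (((D - e) / 8 : ℝ) : EReal)) :
    (∃ j, 4 * g ≤ d j ∧ 8 * g ≤ D - d j) ∨ ∀ j, d j ≤ D - 8 * g := by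
  rcases le_max_iff.1 hg with h | h
  · rcases coe_le_maxOrTop.1 h with h | ⟨j, -, hj⟩
    · refine .inr fun j => ?_
      have := Finset.filter_eq_empty_iff.1 h (Finset.mem_univ j)
      linarith
    · have := le_min_iff.1 hj
      exact .inl ⟨j, by linarith, by linarith⟩
  · have := EReal.coe_le_coe_iff.1 h
    exact .inr fun j => by linarith [he j]

theorem le_of_le_rhoSide (hd : ∃ j, 0 < d j) (he : ∀ j, d j ≤ e)
    (hg : (g : EReal) ≤ max (maxOrTop (Finset.univ.filter fun j => 0 < d j)
      fun j => min (d j / 4) ((D - d j) / 8)) (((D - e) / 8 : ℝ) : EReal)) : 8 * g ≤ D := by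
  obtain ⟨i, hi⟩ := hd
  rcases le_max_iff.1 hg with h | h
  · rcases coe_le_maxOrTop.1 h with h | ⟨j, hj0, hj⟩
    · exact absurd hi (Finset.filter_eq_empty_iff.1 h (Finset.mem_univ i))
    · have := le_min_iff.1 hj
      have := (Finset.mem_filter.1 hj0).2
      linarith
  · have := EReal.coe_le_coe_iff.1 h
    linarith [he i]

end Sides

/-! ### Hardness of suboptimal arms -/

theorem UniqueMaxGap.exists_above_or_below {m : Fin (K - 1)} (h : UniqueMaxGap μ m) (hK : 3 ≤ K)
    (a : Fin K) : (∃ j, 0 < μ j - μ a) ∨ ∃ j, 0 < μ a - μ j := by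
  have := h.lower_lt_upper hK
  rcases upper_le_or_le_lower (μ := μ) m a with ha | ha
  · exact .inr ⟨lowerArm μ m, by linarith⟩
  · exact .inl ⟨upperArm μ m, by linarith⟩

/-- On each side of a suboptimal arm there is an arm that is separated by `gamma μ a` from both ends
of the window of length `deltaMax μ`, or there is no arm at all. -/
theorem UniqueMaxGap.gamma_spec {m : Fin (K - 1)} (h : UniqueMaxGap μ m) (hK : 3 ≤ K) {a : Fin K}
    (ha : a ∈ suboptimal μ m) :
    0 < gamma μ a ∧ gamma μ a ≤ deltaMax μ ∧
      ((∃ j, gamma μ a ≤ μ j - μ a ∧ gamma μ a ≤ deltaMax μ - (μ j - μ a)) ∨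
        ∀ j, μ j - μ a ≤ 0) ∧
      ((∃ j, gamma μ a ≤ μ a - μ j ∧ gamma μ a ≤ deltaMax μ - (μ a - μ j)) ∨
        ∀ j, μ a - μ j ≤ 0) := by
  have hR := h.exists_close_above ha
  have hL := h.exists_close_below ha
  have hpos : 0 < min (gammaLeft μ a) (gammaRight μ a) :=
    lt_min (gammaSide_pos (d := fun j => μ a - μ j)) (gammaSide_pos (d := fun j => μ j - μ a))
  have htop : min (gammaLeft μ a) (gammaRight μ a) ≠ ⊤ := by
    intro hc
    obtain ⟨h1, h2⟩ := min_eq_top.1 hc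
    rcases h.exists_above_or_below hK a with h' | h'
    · exact gammaSide_ne_top (d := fun j => μ j - μ a) hR h' h2
    · exact gammaSide_ne_top (d := fun j => μ a - μ j) hL h' h1
  have hcoe : (gamma μ a : EReal) = min (gammaLeft μ a) (gammaRight μ a) :=
    EReal.coe_toReal htop (ne_bot_of_gt hpos)
  have hg : 0 < gamma μ a := by rw [← EReal.coe_pos, hcoe]; exact hpos
  have h1 := exists_or_forall_of_le_gammaSide (d := fun j => μ j - μ a) hR
    (hcoe.trans_le (min_le_right _ _))
  have h2 := exists_or_forall_of_le_gammaSide (d := fun j => μ a - μ j) hL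
    (hcoe.trans_le (min_le_left _ _))
  refine ⟨hg, ?_, h1, h2⟩
  rcases h1 with ⟨j, hj, hj'⟩ | h1
  · linarith
  · rcases h2 with ⟨j, hj, hj'⟩ | h2
    · linarith
    · rcases h.exists_above_or_below hK a with ⟨j, hj⟩ | ⟨j, hj⟩
      · exact absurd hj (not_lt.2 (h1 j))
      · exact absurd hj (not_lt.2 (h2 j))

/-- The bounds on `rho μ a` that the elimination rule uses; also `rho` is at most a constant factor
below `gamma`. -/
theorem UniqueMaxGap.rho_spec {m : Fin (K - 1)} (h : UniqueMaxGap μ m) (hK : 3 ≤ K) {a : Fin K}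
    (ha : a ∈ suboptimal μ m) :
    gamma μ a / 8 ≤ rho μ a ∧ 8 * rho μ a ≤ deltaMax μ ∧
      ((∃ j, 4 * rho μ a ≤ μ j - μ a ∧ 8 * rho μ a ≤ deltaMax μ - (μ j - μ a)) ∨
        ∀ j, μ j - μ a ≤ deltaMax μ - 8 * rho μ a) ∧
      ((∃ j, 4 * rho μ a ≤ μ a - μ j ∧ 8 * rho μ a ≤ deltaMax μ - (μ a - μ j)) ∨
        ∀ j, μ a - μ j ≤ deltaMax μ - 8 * rho μ a) := by
  obtain ⟨hg, -, hR, hL⟩ := h.gamma_spec hK ha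
  have hle : ((gamma μ a / 8 : ℝ) : EReal) ≤ min (rhoLeft μ a) (rhoRight μ a) :=
    le_min (coe_div_le_rhoSide (d := fun j => μ a - μ j) hg hL)
      (coe_div_le_rhoSide (d := fun j => μ j - μ a) hg hR)
  have heR : ∀ j, μ j - μ a ≤ maxOver Finset.univ μ - μ a := fun j =>
    sub_le_sub_right (le_maxOver (Finset.mem_univ j)) _
  have heL : ∀ j, μ a - μ j ≤ μ a - minOver Finset.univ μ := fun j =>
    sub_le_sub_left (minOver_le (Finset.mem_univ j)) _
  have htop : min (rhoLeft μ a) (rhoRight μ a) ≠ ⊤ := by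
    intro hc
    obtain ⟨h1, h2⟩ := min_eq_top.1 hc
    rcases h.exists_above_or_below hK a with h' | h'
    · exact rhoSide_ne_top (d := fun j => μ j - μ a) h' h2
    · exact rhoSide_ne_top (d := fun j => μ a - μ j) h' h1
  have hcoe : (rho μ a : EReal) = min (rhoLeft μ a) (rhoRight μ a) :=
    EReal.coe_toReal htop (ne_bot_of_le_ne_bot (EReal.coe_ne_bot _) hle)
  have h1 := hcoe.trans_le (min_le_right _ _)
  have h2 := hcoe.trans_le (min_le_left _ _)
  have hD : 8 * rho μ a ≤ deltaMax μ := by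
    rcases h.exists_above_or_below hK a with h' | h'
    · exact le_of_le_rhoSide (d := fun j => μ j - μ a) h' heR h1
    · exact le_of_le_rhoSide (d := fun j => μ a - μ j) h' heL h2
  exact ⟨EReal.coe_le_coe_iff.1 (hle.trans_eq hcoe.symm), hD,
    exists_or_forall_of_le_rhoSide (d := fun j => μ j - μ a) hD heR h1,
    exists_or_forall_of_le_rhoSide (d := fun j => μ a - μ j) hD heL h2⟩

/-! ### Sample sizes -/

theorem one_le_cost (K : ℕ) (δ g : ℝ) : 1 ≤ cost K δ g := le_max_left _ _

theorem three_le_div (hK : 3 ≤ K) (hδ : 0 < δ) (hδ1 : δ < 1) : 3 ≤ (K : ℝ) / δ := by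
  have : (3 : ℝ) ≤ K := by exact_mod_cast hK
  rw [le_div_iff₀ hδ]
  nlinarith

theorem one_le_log_of_three_le {y : ℝ} (hy : 3 ≤ y) : 1 ≤ Real.log y := by
  rw [Real.le_log_iff_exp_le (by linarith)]
  have := Real.exp_one_lt_d9
  linarith

theorem ciRadius_le {x : ℝ} {s : ℕ} (hK : 3 ≤ K) (hδ : 0 < δ) (hδ1 : δ < 1) (hx : 0 < x)
    (hs : 1 ≤ s) (h : 8 * (Real.log (K / (δ * x)) / x ^ 2) ≤ s) : ciRadius K δ s ≤ x := by
  have hA := three_le_div hK hδ hδ1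
  have hs0 : (0 : ℝ) < s := by exact_mod_cast hs
  refine Real.sqrt_le_iff.2 ⟨hx.le, ?_⟩
  rw [div_le_iff₀ hs0]
  have e1 : (4 * K * (s : ℝ) ^ 2 / δ) = 4 * (K / δ) * (s : ℝ) ^ 2 := by ring
  have e2 : (K : ℝ) / (δ * x) = K / δ / x := by rw [div_div]
  rw [e1, Real.log_mul (by positivity) (by positivity), Real.log_mul (by norm_num) (by positivity),
    Real.log_pow]
  rw [e2, Real.log_div (by positivity) hx.ne', ← mul_div_assoc, div_le_iff₀ (by positivity)] at h
  -- `log s ≤ s * x ^ 2 / 4 - 1 + log (4 / x ^ 2)`, by concavity of the logarithm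
  have h1 := Real.log_le_sub_one_of_pos (show 0 < s * x ^ 2 / 4 by positivity)
  rw [Real.log_div (by positivity) (by norm_num), Real.log_mul (by positivity) (by positivity),
    Real.log_pow] at h1
  have h2 := one_le_log_of_three_le hA
  have h3 : Real.log 4 = 2 * Real.log 2 := by
    rw [show (4 : ℝ) = 2 ^ 2 by norm_num, Real.log_pow]; norm_num
  have h4 := Real.log_two_lt_d9
  push_cast at h1 ⊢
  nlinarith

theorem log_div_le_cost {g : ℝ} (hK : 3 ≤ K) (hδ : 0 < δ) (hδ1 : δ < 1) (hg : 0 < g) :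
    Real.log (K / (δ * (g / 8))) / (g / 8) ^ 2 ≤ 256 * cost K δ g := by
  have hA := three_le_div hK hδ hδ1
  have e : (K : ℝ) / (δ * (g / 8)) = 8 * (K / (δ * g)) := by field_simp
  have hlog8 : Real.log 8 ≤ 3 := by
    rw [show (8 : ℝ) = 2 ^ 3 by norm_num, Real.log_pow]
    have := Real.log_two_lt_d9
    push_cast
    linarith
  have hK0 : (0 : ℝ) < K := by exact_mod_cast (by omega : 0 < K)
  rw [e, Real.log_mul (by norm_num) (by positivity)]
  have h1 : Real.log (K / (δ * g)) / g ^ 2 ≤ cost K δ g := le_max_right _ _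
  have h2 : 1 / g ^ 2 ≤ cost K δ g := by
    rcases le_or_gt 1 g with h | h
    · refine le_trans ?_ (one_le_cost K δ g)
      rw [div_le_one (by positivity)]
      nlinarith
    · refine le_trans ?_ h1
      refine div_le_div_of_nonneg_right (one_le_log_of_three_le ?_) (by positivity)
      rw [← div_div, le_div_iff₀ hg]
      nlinarith
  have e3 : (Real.log 8 + Real.log (K / (δ * g))) / (g / 8) ^ 2 =
      64 * (Real.log 8 * (1 / g ^ 2) + Real.log (K / (δ * g)) / g ^ 2) := by
    field_simp
    ring
  rw [e3]
  have h3 : Real.log 8 * (1 / g ^ 2) ≤ 3 * (1 / g ^ 2) :=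
    mul_le_mul_of_nonneg_right hlog8 (by positivity)
  linarith

theorem cost_le_of_div_le {g g' : ℝ} (hK : 3 ≤ K) (hδ : 0 < δ) (hδ1 : δ < 1) (hg : 0 < g)
    (h : g / 8 ≤ g') : cost K δ g' ≤ 256 * cost K δ g := by
  have h1 := one_le_cost K δ g
  have hg' : 0 < g' := lt_of_lt_of_le (by positivity) h
  have hK0 : (0 : ℝ) < K := by exact_mod_cast (by omega : 0 < K)
  refine max_le (by linarith) ?_
  rcases le_or_gt (Real.log (K / (δ * g'))) 0 with h0 | h0
  · exact (div_nonpos_of_nonpos_of_nonneg h0 (by positivity)).trans (by linarith)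
  · refine le_trans ?_ (log_div_le_cost hK hδ hδ1 hg)
    have h3 : Real.log (K / (δ * g')) ≤ Real.log (K / (δ * (g / 8))) := by
      gcongr
    exact div_le_div₀ (h0.le.trans h3) h3 (by positivity) (by gcongr)

/-- A number of samples, of the order of the cost of `g`, from which on the confidence radius is at
most `g / 8`. -/
theorem exists_sampleSize {g : ℝ} (hK : 3 ≤ K) (hδ : 0 < δ) (hδ1 : δ < 1) (hg : 0 < g) :
    ∃ N : ℕ, 1 ≤ N ∧ (N : ℝ) ≤ 2049 * cost K δ g ∧ ∀ s, N ≤ s → ciRadius K δ s ≤ g / 8 := by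
  have h1 := one_le_cost K δ g
  have hN : 1 ≤ ⌈2048 * cost K δ g⌉₊ := Nat.one_le_ceil_iff.2 (by linarith)
  refine ⟨_, hN, ?_, fun s hs => ?_⟩
  · have := Nat.ceil_lt_add_one (show 0 ≤ 2048 * cost K δ g by linarith)
    linarith
  · refine ciRadius_le hK hδ hδ1 (by positivity) (hN.trans hs) ?_
    have h2 := log_div_le_cost hK hδ hδ1 hg
    have h3 := Nat.ceil_le.1 hs
    linarith

/-! ### Concentration -/

section Probability

variable {Ω : Type*} [MeasurableSpace Ω] {P : Measure Ω} {X : Fin K → ℕ → Ω → ℝ}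

theorem IsBandit.measure_sum_le (h : IsBandit P X μ) (a : Fin K) {n : ℕ} (hn : 1 ≤ n) {c : ℝ}
    (hc : 0 ≤ c) :
    P.real {ω | n * c ≤ ∑ i ∈ Finset.range n, (X a i ω - μ a)} ≤ Real.exp (-(n * c ^ 2)) ∧
    P.real {ω | n * c ≤ ∑ i ∈ Finset.range n, -(X a i ω - μ a)} ≤ Real.exp (-(n * c ^ 2)) := by
  have hn0 : (0 : ℝ) < n := by exact_mod_cast hn
  have hsub : ∀ i, HasSubgaussianMGF (fun ω => X a i ω - μ a) (1 / 2) P := fun i =>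
    (h.subgaussian a).congr_identDistrib
      ((h.identDistrib a i).symm.comp (u := fun y => y - μ a) (by fun_prop))
  have e : -(n * c) ^ 2 / (2 * n * ((1 / 2 : ℝ≥0) : ℝ)) = -(n * c ^ 2) := by
    push_cast
    field_simp
  have h1 : iIndepFun (fun i ω => X a i ω - μ a) P :=
    (h.indep a).comp (fun _ y => y - μ a) fun _ => by fun_prop
  have h2 : iIndepFun (fun i ω => -(X a i ω - μ a)) P :=
    (h.indep a).comp (fun _ y => -(y - μ a)) fun _ => by fun_prop
  rw [← e]
  exact ⟨HasSubgaussianMGF.measure_sum_range_ge_le_of_iIndepFun h1 (fun i _ => hsub i)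
      (by positivity),
    HasSubgaussianMGF.measure_sum_range_ge_le_of_iIndepFun h2 (fun i _ => (hsub i).neg)
      (by positivity)⟩

theorem IsBandit.measure_empMean_le [IsProbabilityMeasure P] (h : IsBandit P X μ) (hδ : 0 < δ)
    (hδ1 : δ < 1) (a : Fin K) {n : ℕ} (hn : 1 ≤ n) :
    P {ω | ciRadius K δ n < |empMean (fun i => X a i ω) n - μ a|} ≤
      ENNReal.ofReal (δ / (2 * K) * (1 / (n : ℝ) ^ 2)) := by
  have hn1 : (1 : ℝ) ≤ n := by exact_mod_cast hn
  have hn0 : (0 : ℝ) < n := by linarith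
  have hK1 : (1 : ℝ) ≤ K := by exact_mod_cast Fin.pos a
  set c := ciRadius K δ n with hc
  have hc0 : 0 ≤ c := ciRadius_nonneg K δ n
  have hlog : 0 ≤ Real.log (4 * K * (n : ℝ) ^ 2 / δ) := by
    refine Real.log_nonneg ?_
    rw [le_div_iff₀ hδ]
    have : (1 : ℝ) ≤ (n : ℝ) ^ 2 := one_le_pow₀ hn1
    nlinarith
  have hexp : Real.exp (-(n * c ^ 2)) = δ / (4 * K * (n : ℝ) ^ 2) := by
    rw [hc, ciRadius, Real.sq_sqrt (by positivity), mul_div_cancel₀ _ hn0.ne', ← Real.log_inv,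
      Real.exp_log (by positivity), inv_div]
  obtain ⟨h1, h2⟩ := h.measure_sum_le a hn hc0
  rw [hexp] at h1 h2
  have hsub : {ω | c < |empMean (fun i => X a i ω) n - μ a|} ⊆
      {ω | n * c ≤ ∑ i ∈ Finset.range n, (X a i ω - μ a)} ∪
        {ω | n * c ≤ ∑ i ∈ Finset.range n, -(X a i ω - μ a)} := by
    intro ω hω
    have e : ∑ i ∈ Finset.range n, (X a i ω - μ a) =
        n * (empMean (fun i => X a i ω) n - μ a) := by
      rw [Finset.sum_sub_distrib, empMean, mul_sub, mul_div_cancel₀ _ hn0.ne']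
      simp
    simp only [Set.mem_union, Set.mem_ofPred_eq, Finset.sum_neg_distrib, e, ← mul_neg]
    rcases lt_abs.1 (Set.mem_ofPred_eq ▸ hω) with h' | h'
    · exact .inl (mul_le_mul_of_nonneg_left h'.le hn0.le)
    · exact .inr (mul_le_mul_of_nonneg_left h'.le hn0.le)
  refine (measure_mono hsub).trans ?_
  rw [← ofReal_measureReal]
  refine ENNReal.ofReal_le_ofReal ((measureReal_union_le _ _).trans ?_)
  have : δ / (2 * K) * (1 / (n : ℝ) ^ 2) =
      δ / (4 * K * (n : ℝ) ^ 2) + δ / (4 * K * (n : ℝ) ^ 2) := by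
    field_simp
    ring
  linarith

/-- The union bound over all arms and sample sizes; it closes since `π ^ 2 / 12 ≤ 1`. -/
theorem IsBandit.measure_not_accurate_le [IsProbabilityMeasure P] (h : IsBandit P X μ)
    (hK : 1 ≤ K) (hδ : 0 < δ) (hδ1 : δ < 1) :
    P {ω | ¬ Accurate δ (fun a n => X a n ω) μ} ≤ ENNReal.ofReal δ := by
  have hK0 : (0 : ℝ) < K := by exact_mod_cast hK
  set B : Fin K → ℕ → Set Ω := fun a n =>
    {ω | 1 ≤ n ∧ ciRadius K δ n < |empMean (fun i => X a i ω) n - μ a|}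
  have hB : ∀ a n, P (B a n) ≤ ENNReal.ofReal (δ / (2 * K) * (1 / (n : ℝ) ^ 2)) := by
    intro a n
    rcases Nat.eq_zero_or_pos n with rfl | hn
    · simp [B]
    · exact (measure_mono fun ω hω => hω.2).trans (h.measure_empMean_le hδ hδ1 a hn)
  have hsub : {ω | ¬ Accurate δ (fun a n => X a n ω) μ} ⊆ ⋃ a, ⋃ n, B a n := by
    intro ω hω
    simp only [Accurate, Set.mem_ofPred_eq] at hω
    push Not at hω
    obtain ⟨a, n, hn, hlt⟩ := hω
    exact Set.mem_iUnion.2 ⟨a, Set.mem_iUnion.2 ⟨n, hn, hlt⟩⟩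
  have hsum := hasSum_zeta_two.mul_left (δ / (2 * K))
  have hrow : ∀ a, P (⋃ n, B a n) ≤ ENNReal.ofReal (δ / (2 * K) * (Real.pi ^ 2 / 6)) := by
    intro a
    refine (measure_iUnion_le _).trans ((ENNReal.tsum_le_tsum (hB a)).trans_eq ?_)
    rw [← hsum.tsum_eq, ENNReal.ofReal_tsum_of_nonneg (fun n => by positivity) hsum.summable]
  refine (measure_mono hsub).trans ((measure_iUnion_fintype_le _ _).trans
    ((Finset.sum_le_sum fun a _ => hrow a).trans ?_))
  rw [Finset.sum_const, Finset.card_univ, Fintype.card_fin, nsmul_eq_mul,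
    ← ENNReal.ofReal_natCast, ← ENNReal.ofReal_mul hK0.le]
  refine ENNReal.ofReal_le_ofReal ?_
  have e : (K : ℝ) * (δ / (2 * K) * (Real.pi ^ 2 / 6)) = δ * (Real.pi ^ 2 / 12) := by
    field_simp
    ring
  rw [e]
  have hpi := Real.pi_lt_d2
  have hpi0 := Real.pi_pos
  have : Real.pi ^ 2 / 12 ≤ 1 := by nlinarith
  nlinarith

end Probability

/-! ### Sample complexity on accurate tables -/

variable {m : Fin (K - 1)}

theorem suboptimal_nonempty (hK : 3 ≤ K) : (suboptimal μ m).Nonempty := by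
  rw [suboptimal, ← Finset.card_pos]
  have h1 := Finset.le_card_sdiff {upperArm μ m, lowerArm μ m} (Finset.univ : Finset (Fin K))
  have h2 : ({upperArm μ m, lowerArm μ m} : Finset (Fin K)).card ≤ 2 := Finset.card_le_two
  rw [Finset.card_univ, Fintype.card_fin] at h1
  omega

theorem exists_ne_arm (hK : 3 ≤ K) (i : Fin K) : ∃ k, k ≠ i :=
  have : Nontrivial (Fin K) := Fin.nontrivial_iff_two_le.2 (by omega)
  exists_ne i

/-- The constant is `3 * 2049`: the two remaining arms are each sampled no more often than the
suboptimal arms together. -/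
theorem elim_of_accurate (hK : 3 ≤ K) (hδ : 0 < δ) (hδ1 : δ < 1) (h : UniqueMaxGap μ m)
    (hx : Accurate δ x μ) : ∃ τ, ElimStopsAt δ x τ ∧
      (∀ a ∈ suboptimal μ m, ((elimRun δ x τ).pulls a : ℝ) ≤ 6147 * cost K δ (rho μ a)) ∧
      ∑ a, ((elimRun δ x τ).pulls a : ℝ) ≤ 6147 * ∑ a ∈ suboptimal μ m, cost K δ (rho μ a) ∧
      ∑ a, ((elimRun δ x τ).pulls a : ℝ) ≤
        6147 * 256 * ∑ a ∈ suboptimal μ m, cost K δ (gamma μ a) := by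
  have hpos : ∀ a ∈ suboptimal μ m, 0 < rho μ a := fun a ha =>
    lt_of_lt_of_le (by linarith [(h.gamma_spec hK ha).1]) (h.rho_spec hK ha).1
  have hex : ∀ a, ∃ N : ℕ, a ∈ suboptimal μ m →
      1 ≤ N ∧ (N : ℝ) ≤ 2049 * cost K δ (rho μ a) ∧ a ∉ (elimRun δ x N).next := by
    intro a
    by_cases ha : a ∈ suboptimal μ m
    · obtain ⟨N, hN1, hN2, hN3⟩ := exists_sampleSize hK hδ hδ1 (hpos a ha)
      refine ⟨N, fun _ => ⟨hN1, hN2, ?_⟩⟩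
      obtain ⟨-, hD, hR, hL⟩ := h.rho_spec hK ha
      rw [h.deltaMax_eq] at hD hR hL
      exact notMem_elimRun_next hx (exists_ne_arm hK) (upper_le_or_le_lower m)
        (h.lower_lt_upper hK) le_rfl le_rfl hD hR hL hN1
        ((hN3 N le_rfl).trans_lt (by linarith [hpos a ha]))
    · exact ⟨0, fun h' => absurd h' ha⟩
  choose N hN using hex
  obtain ⟨τ, hτ, h1, h2⟩ := exists_elimStopsAt (δ := δ) (x := x) (S := suboptimal μ m) rfl
    (suboptimal_nonempty hK) (fun a ha => (hN a ha).1) (fun a ha => (hN a ha).2.2)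
  have hρ : ∑ a, ((elimRun δ x τ).pulls a : ℝ) ≤
      6147 * ∑ a ∈ suboptimal μ m, cost K δ (rho μ a) := by
    have h3 : ∑ a, ((elimRun δ x τ).pulls a : ℝ) ≤ 3 * ∑ a ∈ suboptimal μ m, (N a : ℝ) := by
      exact_mod_cast h2
    have h4 : ∑ a ∈ suboptimal μ m, (N a : ℝ) ≤
        2049 * ∑ a ∈ suboptimal μ m, cost K δ (rho μ a) := by
      rw [Finset.mul_sum]
      exact Finset.sum_le_sum fun a ha => (hN a ha).2.1
    linarith
  refine ⟨τ, hτ, fun a ha => ?_, hρ, hρ.trans ?_⟩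
  · have h3 : ((elimRun δ x τ).pulls a : ℝ) ≤ N a := by exact_mod_cast h1 a ha
    have := (hN a ha).2.1
    have := one_le_cost K δ (rho μ a)
    linarith
  · rw [mul_assoc, Finset.mul_sum _ _ (256 : ℝ)]
    refine mul_le_mul_of_nonneg_left (Finset.sum_le_sum fun a ha => ?_) (by norm_num)
    exact cost_le_of_div_le hK hδ hδ1 (h.gamma_spec hK ha).1 (h.rho_spec hK ha).1

/-- The constant `6147` is `3 * 2049`; the total allows for two more samples, those that the two
arms at the largest gap may receive in the last round. -/
theorem ucb_of_accurate (hK : 3 ≤ K) (hδ : 0 < δ) (hδ1 : δ < 1) (h : UniqueMaxGap μ m)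
    (hx : Accurate δ x μ) {c : ℝ} (hc : 0 < c) : ∃ τ, UCBStopsAt c δ x τ ∧
      (∀ a ∈ suboptimal μ m, ((ucbRun δ x τ).pulls a : ℝ) ≤ 6147 * cost K δ (gamma μ a)) ∧
      ∑ a, ((ucbRun δ x τ).pulls a : ℝ) ≤
        6149 * (1 + c) * ∑ a ∈ suboptimal μ m, cost K δ (gamma μ a) := by
  have hlt := h.lower_lt_upper hK
  have hne : upperArm μ m ≠ lowerArm μ m := fun e => by
    rw [e] at hlt
    exact lt_irrefl _ hlt
  have hpulls : ∀ t, ∀ a ∈ suboptimal μ m,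
      ((ucbRun δ x t).pulls a : ℝ) ≤ 6147 * cost K δ (gamma μ a) := by
    intro t a ha
    obtain ⟨hg, hD, hR, hL⟩ := h.gamma_spec hK ha
    rw [h.deltaMax_eq] at hD hR hL
    simp only [sub_nonpos] at hR hL
    obtain ⟨N, hN1, hN2, hN3⟩ := exists_sampleSize hK hδ hδ1 hg
    have h1 : ((ucbRun δ x t).pulls a : ℝ) ≤ 3 * N := by
      exact_mod_cast ucbRun_pulls_le hx (exists_ne_arm hK) (upper_le_or_le_lower m) rfl le_rfl
        hne.symm (c := gamma μ a / 8) (by positivity) (by linarith) hD hR hL hN1 hN3 t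
    linarith
  obtain ⟨τ, hτ, hsum⟩ := exists_ucbStopsAt (δ := δ) (x := x) hne hc (S := suboptimal μ m) rfl
    (M := 6147 * ∑ a ∈ suboptimal μ m, cost K δ (gamma μ a)) fun t => by
      rw [Finset.mul_sum]
      exact Finset.sum_le_sum (hpulls t)
  refine ⟨τ, hτ, hpulls τ, hsum.trans ?_⟩
  obtain ⟨a₀, ha₀⟩ := suboptimal_nonempty (μ := μ) (m := m) hK
  have h1 : 1 ≤ ∑ a ∈ suboptimal μ m, cost K δ (gamma μ a) :=
    (one_le_cost K δ (gamma μ a₀)).trans (Finset.single_le_sum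
      (f := fun a => cost K δ (gamma μ a))
      (fun a _ => zero_le_one.trans (one_le_cost K δ (gamma μ a))) ha₀)
  nlinarith

end MaxGap

open MaxGap in
theorem mainTheorem2 :
    ∃ α C : ℝ, 0 < α ∧ 0 < C ∧
      (∀ (K : ℕ) (δ x : ℝ) (s : ℕ), 3 ≤ K → 0 < δ → δ < 1 → 0 < x → 1 ≤ s →
        α * Real.log (K / (δ * x)) / x ^ 2 ≤ s → ciRadius K δ s ≤ x) ∧
      ∀ (Ω : Type*) [MeasurableSpace Ω] (P : Measure Ω) [IsProbabilityMeasure P]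
        (K : ℕ) (δ : ℝ) (X : Fin K → ℕ → Ω → ℝ) (μ : Fin K → ℝ) (m : Fin (K - 1)),
        3 ≤ K → 0 < δ → δ < 1 → IsBandit P X μ → UniqueMaxGap μ m →
        P {ω | ¬ ∃ τ : ℕ, ElimStopsAt δ (fun a n => X a n ω) τ ∧
            (∀ a ∈ suboptimal μ m,
              ((elimRun δ (fun a n => X a n ω) τ).pulls a : ℝ) ≤ α * cost K δ (rho μ a)) ∧
            ∑ a, ((elimRun δ (fun a n => X a n ω) τ).pulls a : ℝ)
              ≤ α * ∑ a ∈ suboptimal μ m, cost K δ (rho μ a) ∧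
            ∑ a, ((elimRun δ (fun a n => X a n ω) τ).pulls a : ℝ)
              ≤ C * ∑ a ∈ suboptimal μ m, cost K δ (gamma μ a)} ≤ ENNReal.ofReal δ ∧
        ∀ c : ℝ, 0 < c →
          P {ω | ¬ ∃ τ : ℕ, UCBStopsAt c δ (fun a n => X a n ω) τ ∧
              (∀ a ∈ suboptimal μ m,
                ((ucbRun δ (fun a n => X a n ω) τ).pulls a : ℝ) ≤ 6 * α * cost K δ (gamma μ a)) ∧
              ∑ a ∈ suboptimal μ m, ((ucbRun δ (fun a n => X a n ω) τ).pulls a : ℝ)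
                ≤ 6 * α * ∑ a ∈ suboptimal μ m, cost K δ (gamma μ a) ∧
              ∑ a, ((ucbRun δ (fun a n => X a n ω) τ).pulls a : ℝ)
                ≤ C * (1 + c) * ∑ a ∈ suboptimal μ m, cost K δ (gamma μ a)} ≤
            ENNReal.ofReal δ := by
  refine ⟨6147, 6147 * 256, by norm_num, by norm_num, ?_, ?_⟩
  · intro K δ x s hK hδ hδ1 hx hs h
    refine ciRadius_le hK hδ hδ1 hx hs ?_
    rw [mul_div_assoc] at h
    have : (0 : ℝ) ≤ s := Nat.cast_nonneg s
    -- a negative logarithm makes the hypothesis weaker, but then the bound is trivial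
    rcases le_total (Real.log (K / (δ * x)) / x ^ 2) 0 with h0 | h0 <;> linarith
  · intro Ω _ P _ K δ X μ m hK hδ hδ1 hX hm
    have hbad := hX.measure_not_accurate_le (by omega) hδ hδ1
    refine ⟨(measure_mono ?_).trans hbad, fun c hc => (measure_mono ?_).trans hbad⟩
    · exact fun ω hω hx => hω (elim_of_accurate hK hδ hδ1 hm hx)
    · intro ω hω hx
      obtain ⟨τ, hτ, h1, h2⟩ := ucb_of_accurate hK hδ hδ1 hm hx hc
      have hcost : ∀ a, 0 ≤ cost K δ (gamma μ a) := fun a =>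
        zero_le_one.trans (one_le_cost K δ (gamma μ a))
      have h1' : ∀ a ∈ suboptimal μ m, ((ucbRun δ (fun a n => X a n ω) τ).pulls a : ℝ) ≤
          6 * 6147 * cost K δ (gamma μ a) := fun a ha => by
        have := h1 a ha
        have := hcost a
        linarith
      refine hω ⟨τ, hτ, h1', ?_, h2.trans ?_⟩
      · rw [Finset.mul_sum]
        exact Finset.sum_le_sum h1'
      · refine mul_le_mul_of_nonneg_right (mul_le_mul_of_nonneg_right (by norm_num) (by linarith))
          (Finset.sum_nonneg fun a _ => hcost a)
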